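/- All graphs are finite and simple. For a graph $G$ and an integer $t\ge 1$ let $s_t(G)$ be the number of $t$-stars in $G$, that is, the number of subgraphs of $G$ isomorphic to $K_{1,t}$; thus $s_t(G)=\sum_{v}\binom{\deg v}{t}$ for $t\ge 2$, and $s_1(G)=e(G)$. For integers $n,\ell,i$ with $-1\le \ell\le n-3$ and $1\le i\le \frac{n-1-\ell}{2}$, let $G^\ell_n(i)$ be the $n$-vertex graph $K_{i+\ell}+(I_i\cup K_{n-2i-\ell})$, where $I_i$ is the edgeless graph on $i$ vertices, $\cup$ is disjoint union and $+$ is the join (all edges between the two parts are added); when $i+\ell=0$ this is $I_1\cup K_{n-1}$. Put $i_0=\lfloor\frac{n-1-\ell}{2}\rfloor$ and, for an integer $d\ge 0$ (taken at most $\frac{n+\ell-1}{2}$ below), $i_d=\max\{1,d-\ell\}$; here $i_0$ denotes the floor above even when $d=0$. Consider one of the following five properties $P$ of $n$-vertex graphs, with its integer $\ell$: 1. Hamiltonian (having a spanning cycle), $\ell=0$; 2. traceable (having a spanning path), $\ell=-1$; 3. Hamiltonian-connected (any two distinct vertices are the ends of a spanning path), $\ell=1$; 4. $k$-edge Hamiltonian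 for a given integer $1\le k\le n-3$ (every linear forest in the graph with at most $k$ edges is contained in a spanning cycle of the graph, a linear forest being a disjoint union of paths), $\ell=k$; 5. $k$-Hamiltonian for a given integer $1\le k\le n-3$ (removing any set of at most $k$ vertices leaves a Hamiltonian graph), $\ell=k$. **Theorem.** Let $P$ and $\ell$ be as in one of these five cases, and let $n,d,t$ be integers with $n\ge \ell+3$, $0\le d\le \lfloor\frac{n+\ell-1}{2}\rfloor$ and $1\le t\le n-1$. Then every $n$-vertex graph $G$ with minimum degree $\delta(G)\ge d$ that does not have property $P$ satisfies $$s_t(G)\le \max\{s_t(G^\ell_n(i_d)),\,s_t(G^\ell_n(i_0))\},$$ and the bound is tight: for all such $P,\ell,n,d,t$ there is an $n$-vertex graph with minimum degree at least $d$, without property $P$, for which equality holds. -/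

import Mathlib

namespace StarsForbidden

open SimpleGraph

/-- The number of `t`-stars of `G`: the number of (not necessarily induced, unlabelled)
subgraphs of `G` that are isomorphic to `K_{1,t}`. For `t = 1` this is the number of edges. -/
noncomputable def starCount {V : Type*} [Fintype V] (t : ℕ) (G : SimpleGraph V) : ℕ :=
  G.copyCount (completeBipartiteGraph (Fin 1) (Fin t))

/-- The join of two graphs: their disjoint union together with all edges between them. -/
def join {V W : Type*} (G : SimpleGraph V) (H : SimpleGraph W) : SimpleGraph (V ⊕ W) :=
  (G ⊕g H) ⊔ completeBipartiteGraph V W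

/-- The graph `K_{i+ℓ} + (I_i ∪ K_{n-2i-ℓ})`, where `+` is the join, `∪` the disjoint union and
`I_i` the graph with `i` vertices and no edge. It is meant for `-1 ≤ ℓ ≤ n - 3` and
`1 ≤ i ≤ (n - 1 - ℓ) / 2`; then all three orders are nonnegative and it has `n` vertices. -/
def extremalGraph (n : ℕ) (ℓ i : ℤ) :
    SimpleGraph (Fin (i + ℓ).toNat ⊕ (Fin i.toNat ⊕ Fin (n - 2 * i - ℓ).toNat)) :=
  join (completeGraph (Fin (i + ℓ).toNat))
    (emptyGraph (Fin i.toNat) ⊕g completeGraph (Fin (n - 2 * i - ℓ).toNat))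

/-- The largest index `i₀ = ⌊(n - 1 - ℓ) / 2⌋` (integer division rounds down here). -/
def iTop (n : ℕ) (ℓ : ℤ) : ℤ := (n - 1 - ℓ) / 2

/-- The index `i_d = max {1, d - ℓ}`. -/
def iMin (d : ℕ) (ℓ : ℤ) : ℤ := max 1 (d - ℓ)

section Properties

variable {V : Type*} [Fintype V] [DecidableEq V]

/-- `G` contains a Hamilton path. -/
def IsTraceable (G : SimpleGraph V) : Prop :=
  ∃ u v : V, ∃ p : G.Walk u v, p.IsHamiltonian

/-- Any two distinct vertices of `G` are the ends of a Hamilton path. -/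
def IsHamiltonianConnected (G : SimpleGraph V) : Prop :=
  ∀ u v : V, u ≠ v → ∃ p : G.Walk u v, p.IsHamiltonian

/-- A linear forest is a disjoint union of paths: an acyclic graph in which every vertex has at
most two neighbours. -/
def IsLinearForest (F : SimpleGraph V) : Prop :=
  F.IsAcyclic ∧ ∀ v : V, (F.neighborSet v).ncard ≤ 2

/-- Every linear forest in `G` with at most `k` edges is contained in a Hamilton cycle of `G`.
(Adding isolated vertices to a linear forest changes nothing, so spanning ones suffice.) -/
def IsEdgeHamiltonian (k : ℕ) (G : SimpleGraph V) : Prop :=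
  ∀ F : SimpleGraph V, F ≤ G → IsLinearForest F → F.edgeSet.ncard ≤ k →
    ∃ (a : V) (p : G.Walk a a), p.IsHamiltonianCycle ∧ ∀ e ∈ F.edgeSet, e ∈ p.edges

/-- The removal of any set of at most `k` vertices results in a Hamiltonian graph. -/
def IsKHamiltonian (k : ℕ) (G : SimpleGraph V) : Prop :=
  ∀ S : Finset V, S.card ≤ k → (G.induce ((Sᶜ : Finset V) : Set V)).IsHamiltonian

end Properties

end StarsForbidden

namespace StarsForbidden

open SimpleGraph

/-! All five properties share three features, collected in `IsHamiltonLike`: an edge `uv` with `deg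
u + deg v ≥ n + ℓ` is irrelevant to the property (Bondy–Chvátal stability), complete graphs have it,
and a barrier (`IsBarrier`) excludes it. Each is verified by reduction to Hamilton cycles through a
prescribed edge set `F` (`HamThrough`): traceability passes to the cone, Hamiltonian-connectedness
to `G + uv` with `F = {uv}`, and `k`-Hamiltonicity to induced subgraphs.

For the upper bound, enlarge `G` to an edge-maximal graph `G'` without the property. By stability,
non-adjacent vertices have degree sum below `n + ℓ`. A non-adjacent pair of largest degree sum then
yields, as in Chvátal's theorem, some `i` and `a = i + ℓ` such that at least `i` vertices have
degree at most `a` and at least `n - a` have degree at most `n - 1 - i` (`exists_degree_bounds`). So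
the degree sequence is dominated by that of the extremal graph of index `i`, and `∑ (deg v choose
t)` is at most `starSum n t a i`. The minimum degree forces `i ≥ i_d`, and `starSum` is convex along
`(a + j, i + j)`, so one of the two end indices gives the maximum.

The number of stars enters only through `starCount * |Aut| = t! * ∑ (deg v choose t)`, so comparing
the sums suffices. The extremal graphs contain a barrier, which gives tightness. -/

/-! ### Hamilton cycles through given edges -/

/-- A Hamilton path whose ends are adjacent closes up to a Hamilton cycle. -/
lemma isHamiltonianCycle_cons {V : Type*} [DecidableEq V] [Fintype V] {G : SimpleGraph V} {u v : V} {q : G.Walk u v}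
    (hq : q.IsHamiltonian) (h : G.Adj v u) (hV : 3 ≤ Fintype.card V) :
    (Walk.cons h q).IsHamiltonianCycle := by
  rw [Walk.isHamiltonianCycle_iff_isCycle_and_length_eq, Walk.cons_isCycle_iff]
  have hl := hq.length_eq
  refine ⟨⟨hq.isPath, fun he => ?_⟩, by rw [Walk.length_cons]; omega⟩
  have := hq.isPath.length_eq_one_of_mem_edges (Sym2.eq_swap ▸ he)
  omega

/-- A walk splits at each of its steps. -/
lemma exists_eq_append_cons {V : Type*} {G : SimpleGraph V} {u v : V} (q : G.Walk u v) {i : ℕ}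
    (hi : i < q.length) :
    ∃ (w w' : V) (q₁ : G.Walk u w) (h : G.Adj w w') (q₂ : G.Walk w' v),
      q = q₁.append (Walk.cons h q₂) ∧ w = q.getVert i ∧ w' = q.getVert (i + 1) := by
  induction q generalizing i with
  | nil => simp at hi
  | cons h q ih =>
    cases i with
    | zero => exact ⟨_, _, Walk.nil, h, q, rfl, rfl, by simp⟩
    | succ i =>
      obtain ⟨w, w', q₁, h', q₂, rfl, hw, hw'⟩ := ih (i := i) (by simpa using hi)
      exact ⟨w, w', Walk.cons h q₁, h', q₂, rfl, by simpa using hw, by simpa using hw'⟩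

/-- In a Hamilton path whose ends have large degree sum there is a step, outside a given small set
of edges, at which the path may be reconnected. -/
lemma exists_crossing {V : Type*} [DecidableEq V] [Fintype V] {G : SimpleGraph V} [DecidableRel G.Adj] {u v : V}
    {q : G.Walk u v} (hq : q.IsHamiltonian) (F : Set (Sym2 V)) {k : ℕ} (hF : F.ncard ≤ k)
    (hdeg : Fintype.card V + k ≤ G.degree u + G.degree v) :
    ∃ i < q.length, G.Adj u (q.getVert (i + 1)) ∧ G.Adj v (q.getVert i) ∧
      s(q.getVert i, q.getVert (i + 1)) ∉ F := by
  classical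
  have hl := hq.length_eq
  have hV : 0 < Fintype.card V := Fintype.card_pos_iff.2 ⟨u⟩
  have hinj : ∀ i j, i ≤ q.length → j ≤ q.length → q.getVert i = q.getVert j → i = j :=
    fun i j hi hj h => hq.isPath.getVert_injOn hi hj h
  -- `A` and `B` have at least `deg u` and `deg v` elements, but their union lies among the `n - 1`
  -- steps of the path. So they share at least `k + 1` steps, more than the at most `k` steps in
  -- `C`.
  set A := (Finset.range q.length).filter fun i => G.Adj u (q.getVert (i + 1))
  set B := (Finset.range q.length).filter fun i => G.Adj v (q.getVert i)
  set C := (Finset.range q.length).filter fun i => s(q.getVert i, q.getVert (i + 1)) ∈ F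
  have hsurj : ∀ w, ∃ i ≤ q.length, q.getVert i = w := fun w => by
    obtain ⟨i, hi, hi'⟩ := (Walk.mem_support_iff_exists_getVert).1 (hq.mem_support w)
    exact ⟨i, hi', hi⟩
  have hA : G.degree u ≤ A.card := by
    rw [← card_neighborFinset_eq_degree]
    refine (Finset.card_le_card fun w hw => ?_).trans
      (Finset.card_image_le (s := A) (f := fun i => q.getVert (i + 1)))
    rw [mem_neighborFinset] at hw
    obtain ⟨i, hi, rfl⟩ := hsurj w
    cases i with
    | zero => simp at hw
    | succ i => exact Finset.mem_image.2 ⟨i, by simpa [A] using ⟨by omega, hw⟩, rfl⟩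
  have hB : G.degree v ≤ B.card := by
    rw [← card_neighborFinset_eq_degree]
    refine (Finset.card_le_card fun w hw => ?_).trans
      (Finset.card_image_le (s := B) (f := fun i => q.getVert i))
    rw [mem_neighborFinset] at hw
    obtain ⟨i, hi, rfl⟩ := hsurj w
    have : i ≠ q.length := by rintro rfl; simp at hw
    exact Finset.mem_image.2 ⟨i, by simpa [B] using ⟨by omega, hw⟩, rfl⟩
  have hC : C.card ≤ k := by
    rw [← Set.ncard_coe_finset]
    refine le_trans (Set.ncard_le_ncard_of_injOn
      (fun i => s(q.getVert i, q.getVert (i + 1))) ?_ ?_ (Set.toFinite F)) hF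
    · intro i hi
      simpa [C] using (Finset.mem_filter.1 hi).2
    · intro i hi j hj h
      have hi := Finset.mem_range.1 (Finset.mem_filter.1 hi).1
      have hj := Finset.mem_range.1 (Finset.mem_filter.1 hj).1
      rcases Sym2.eq_iff.1 h with ⟨h1, -⟩ | ⟨h1, h2⟩
      · exact hinj _ _ hi.le hj.le h1
      · have := hinj _ _ hi.le (by omega) h1
        have := hinj _ _ (by omega) hj.le h2
        omega
  have hAB : C.card < (A ∩ B).card := by
    have h1 := Finset.card_union_add_card_inter A B
    have h2 : (A ∪ B).card ≤ q.length := by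
      rw [← Finset.card_range q.length]
      exact Finset.card_le_card
        (Finset.union_subset (Finset.filter_subset _ _) (Finset.filter_subset _ _))
    omega
  obtain ⟨i, hi, hiC⟩ := Finset.exists_mem_notMem_of_card_lt_card hAB
  rw [Finset.mem_inter, Finset.mem_filter, Finset.mem_filter, Finset.mem_range] at hi
  exact ⟨i, hi.1.1, hi.1.2, hi.2.2, fun h => hiC (Finset.mem_filter.2
    ⟨Finset.mem_range.2 hi.1.1, h⟩)⟩

/-- Some Hamilton cycle of `G` contains all elements of `F`. -/
def HamThrough {V : Type*} [DecidableEq V] (G : SimpleGraph V) (F : Set (Sym2 V)) : Prop :=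
  ∃ (a : V) (p : G.Walk a a), p.IsHamiltonianCycle ∧ ∀ e ∈ F, e ∈ p.edges

/-- Ore's argument: a Hamilton path with ends of large degree sum can be turned into a Hamilton
cycle without losing any edge of a given small set. -/
lemma hamThrough_of_path {V : Type*} [DecidableEq V] [Fintype V] {G : SimpleGraph V} [DecidableRel G.Adj] {u v : V}
    {q : G.Walk u v} (hq : q.IsHamiltonian) {F : Set (Sym2 V)} {k : ℕ} (hF : F.ncard ≤ k)
    (hFq : ∀ e ∈ F, e ∈ q.edges) (hV : 3 ≤ Fintype.card V)
    (hdeg : Fintype.card V + k ≤ G.degree u + G.degree v) : HamThrough G F := by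
  obtain ⟨i, hi, h1, h2, h3⟩ := exists_crossing hq F hF hdeg
  obtain ⟨w, w', q₁, h, q₂, rfl, hw, hw'⟩ := exists_eq_append_cons q hi
  rw [← hw, ← hw'] at h3
  rw [← hw'] at h1
  rw [← hw] at h2
  -- Go from `u` to `w`, jump to `v`, and return along the path to `w'`, which is adjacent to `u`.
  -- Only the edge `ww'`, not in `F`, is lost.
  have hr : (q₁.append (Walk.cons h2.symm q₂.reverse)).IsHamiltonian := by
    intro x
    have := hq x
    simpa [Walk.support_append] using this
  refine ⟨_, _, isHamiltonianCycle_cons hr h1.symm hV, fun e he => ?_⟩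
  have hne : e ≠ s(w, w') := fun h => h3 (h ▸ he)
  have := hFq e he
  simp only [Walk.edges_append, Walk.edges_cons, List.mem_append, List.mem_cons, hne,
    Walk.edges_reverse, List.mem_reverse, false_or] at this ⊢
  tauto

/-- A Hamilton cycle may be traversed starting with any of its edges. -/
lemma exists_isHamiltonianCycle_cons {V : Type*} [DecidableEq V] [Fintype V] {G : SimpleGraph V}
    {a : V} {p : G.Walk a a} (hp : p.IsHamiltonianCycle) {x y : V} (hxy : s(x, y) ∈ p.edges) :
    ∃ (h : G.Adj x y) (q : G.Walk y x), (Walk.cons h q).IsHamiltonianCycle ∧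
      ∀ e ∈ p.edges, e ∈ (Walk.cons h q).edges := by
  have hV : 3 ≤ Fintype.card V := hp.length_eq ▸ hp.isCycle.three_le_length
  have hx : x ∈ p.support := hp.mem_support x
  have hp' := hp.rotate hx
  have he : ∀ e, e ∈ (p.rotate x hx).edges ↔ e ∈ p.edges := fun e => (p.rotate_edges x hx).mem_iff
  generalize p.rotate x hx = p' at hp' he
  rw [← he] at hxy
  cases p' with
  | nil => simp at hxy
  | @cons _ z _ h q =>
    have hq : q.IsHamiltonian := by
      intro v
      simpa using (Walk.isHamiltonianCycle_iff_isCycle_and_support_count_tail_eq_one.1 hp').2 v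
    rw [Walk.edges_cons, List.mem_cons] at hxy
    by_cases hyz : y = z
    · subst hyz
      exact ⟨h, q, hp', fun e h => (he e).2 h⟩
    -- After rotation to `x`, an edge at `x` that is not the first one must be the last one; the
    -- cycle is then traversed backwards.
    have hxy : s(x, y) ∈ q.reverse.edges := by
      rcases hxy with hxy | hxy
      · exact absurd (Sym2.congr_right.1 hxy) hyz
      · simpa using hxy
    obtain ⟨r, rfl⟩ : ∃ r : G.Walk x z, q = r.reverse := ⟨q.reverse, by simp⟩
    rw [Walk.reverse_reverse] at hxy
    cases r with
    | nil => simp at hxy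
    | @cons _ w _ h' r =>
      have hr := hq.isPath
      rw [Walk.isPath_reverse_iff, Walk.cons_isPath_iff] at hr
      have hyw : y = w := by
        rw [Walk.edges_cons, List.mem_cons] at hxy
        rcases hxy with hxy | hxy
        · exact Sym2.congr_right.1 hxy
        · exact absurd (Walk.fst_mem_support_of_mem_edges _ hxy) hr.2
      subst hyw
      refine ⟨h', r.concat h.symm, isHamiltonianCycle_cons (fun v => ?_) h' hV, fun e hep => ?_⟩
      · have := hq v
        simp only [Walk.support_reverse, Walk.support_cons, List.count_reverse, List.count_cons,
          Walk.support_concat, List.count_append, List.count_nil] at this ⊢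
        omega
      · have := (he e).2 hep
        simp only [Walk.edges_cons, Walk.edges_reverse, List.mem_cons, List.mem_reverse,
          Walk.edges_concat, List.concat_eq_append, List.mem_append, List.not_mem_nil,
          or_false, Sym2.eq_swap (a := z)] at this ⊢
        tauto

lemma mem_edgeSet_of_mem_edges_sup_edge {V : Type*} {G : SimpleGraph V} {u v a b : V}
    {p : (G ⊔ edge u v).Walk a b} (h : s(u, v) ∉ p.edges) : ∀ e ∈ p.edges, e ∈ G.edgeSet := by
  intro e he
  have := p.edges_subset_edgeSet he
  rw [edgeSet_sup] at this
  refine this.resolve_right fun h' => h ?_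
  induction e with
  | _ x y =>
    rw [mem_edgeSet, edge_adj] at h'
    rcases h'.1 with ⟨rfl, rfl⟩ | ⟨rfl, rfl⟩
    · exact he
    · exact Sym2.eq_swap ▸ he

lemma isHamiltonian_transfer {V : Type*} [DecidableEq V] {G H : SimpleGraph V} {a b : V}
    {p : G.Walk a b} (hp : p.IsHamiltonian) (h : ∀ e ∈ p.edges, e ∈ H.edgeSet) :
    (p.transfer H h).IsHamiltonian := by
  intro v
  rw [Walk.support_transfer]
  exact hp v

lemma hamThrough_transfer {V : Type*} [DecidableEq V] [Fintype V] {G H : SimpleGraph V} {a : V}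
    {p : G.Walk a a} (hp : p.IsHamiltonianCycle) (h : ∀ e ∈ p.edges, e ∈ H.edgeSet)
    {F : Set (Sym2 V)} (hF : ∀ e ∈ F, e ∈ p.edges) : HamThrough H F := by
  refine ⟨a, p.transfer H h, ?_, fun e he => by simpa using hF e he⟩
  rw [Walk.isHamiltonianCycle_iff_isCycle_and_length_eq] at hp ⊢
  exact ⟨hp.1.transfer h, by simpa using hp.2⟩

/-- A Hamilton cycle through the added edge `uv` of `G + uv` gives a Hamilton path of `G`. -/
lemma exists_path_of_mem_edges {V : Type*} [DecidableEq V] [Fintype V] {G : SimpleGraph V}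
    {u v a : V} {p : (G ⊔ edge u v).Walk a a} (hp : p.IsHamiltonianCycle) (h : s(u, v) ∈ p.edges) :
    ∃ q : G.Walk v u, q.IsHamiltonian ∧ ∀ e ∈ p.edges, e = s(u, v) ∨ e ∈ q.edges := by
  obtain ⟨h', q, hq, he⟩ := exists_isHamiltonianCycle_cons hp h
  have hq' : q.IsHamiltonian := by
    intro v
    simpa using (Walk.isHamiltonianCycle_iff_isCycle_and_support_count_tail_eq_one.1 hq).2 v
  have hn := ((Walk.cons_isCycle_iff _ _).1 hq.isCycle).2
  exact ⟨q.transfer G (mem_edgeSet_of_mem_edges_sup_edge hn), isHamiltonian_transfer hq' _,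
    fun e hep => by simpa using he e hep⟩

/-- Bondy and Chvátal's stability: an edge joining two vertices of large degree sum is not needed
for a Hamilton cycle through a small set of edges. -/
lemma HamThrough.of_sup_edge {V : Type*} [DecidableEq V] [Fintype V] {G : SimpleGraph V}
    [DecidableRel G.Adj] {u v : V} {F : Set (Sym2 V)} (hFG : F ⊆ G.edgeSet) {k : ℕ}
    (hF : F.ncard ≤ k) (hdeg : Fintype.card V + k ≤ G.degree u + G.degree v)
    (h : HamThrough (G ⊔ edge u v) F) : HamThrough G F := by
  by_cases huv : G.Adj u v ∨ u = v
  · have : G ⊔ edge u v = G := by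
      rcases huv with huv | rfl
      · exact G.sup_edge_of_adj huv
      · exact G.sup_edge_self u
    rwa [this] at h
  obtain ⟨a, p, hp, hFp⟩ := h
  have hV : 3 ≤ Fintype.card V := hp.length_eq ▸ hp.isCycle.three_le_length
  by_cases he : s(u, v) ∈ p.edges
  · obtain ⟨q, hq, heq⟩ := exists_path_of_mem_edges hp he
    refine hamThrough_of_path hq hF (fun e heF => (heq e (hFp e heF)).resolve_left ?_) hV
      (by omega)
    rintro rfl
    exact huv (Or.inl (hFG heF))
  · exact hamThrough_transfer hp (mem_edgeSet_of_mem_edges_sup_edge he) hFp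

lemma pair_infix_append {α : Type*} {x y : α} {s t : List α} :
    [x, y] <:+: s ++ t ↔ [x, y] <:+: s ∨ [x, y] <:+: t ∨ ∃ s' t', s = s' ++ [x] ∧ t = y :: t' := by
  induction s with
  | nil => simp
  | cons a s ih =>
    rw [List.cons_append, List.infix_cons_iff, List.infix_cons_iff, ih]
    constructor
    · rintro (h | h | h | ⟨s', t', rfl, rfl⟩)
      · rw [List.cons_prefix_cons] at h
        obtain ⟨rfl, h⟩ := h
        cases s with
        | nil =>
          obtain ⟨t', rfl⟩ := h
          exact Or.inr (Or.inr ⟨[], t', rfl, rfl⟩)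
        | cons b s =>
          rw [List.cons_append, List.cons_prefix_cons] at h
          obtain ⟨rfl, -⟩ := h
          exact Or.inl (Or.inl ⟨s, rfl⟩)
      · exact Or.inl (Or.inr h)
      · exact Or.inr (Or.inl h)
      · exact Or.inr (Or.inr ⟨a :: s', t', rfl, rfl⟩)
    · rintro ((h | h) | h | ⟨s', t', h, rfl⟩)
      · exact Or.inl (h.trans (List.prefix_append _ _))
      · exact Or.inr (Or.inl h)
      · exact Or.inr (Or.inr (Or.inl h))
      · cases s' with
        | nil =>
          simp only [List.nil_append, List.cons.injEq] at h
          obtain ⟨rfl, rfl⟩ := h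
          exact Or.inl ⟨t', rfl⟩
        | cons b s' =>
          simp only [List.cons_append, List.cons.injEq] at h
          exact Or.inr (Or.inr (Or.inr ⟨s', t', h.2, rfl⟩))

/-- Extend the forest to a spanning tree of the complete graph; a leaf of that tree will do. -/
lemma exists_degree_le_one_of_isAcyclic {V : Type*} [Finite V] [Nonempty V] {G : SimpleGraph V}
    (hG : G.IsAcyclic) : ∃ v, ∀ x y, G.Adj v x → G.Adj v y → x = y := by
  classical
  cases nonempty_fintype V
  cases subsingleton_or_nontrivial V
  · obtain ⟨v⟩ := ‹Nonempty V›
    exact ⟨v, fun x y _ _ => Subsingleton.elim _ _⟩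
  obtain ⟨T, hT, -, hT'⟩ := (connected_top (V := V)).exists_isTree_le_of_le_of_isAcyclic le_top hG
  obtain ⟨v, hv⟩ := hT'.exists_vert_degree_one_of_nontrivial
  rw [degree_eq_one_iff_existsUnique_adj] at hv
  exact ⟨v, fun x y hx hy => hv.unique (hT hx) (hT hy)⟩

/-- The vertices can be listed so that all edges of a linear forest join consecutive vertices. -/
lemma IsLinearForest.exists_list {V : Type*} [Fintype V] [DecidableEq V] {F : SimpleGraph V}
    (hF : IsLinearForest F) (S : Finset V) :
    ∃ l : List V, l.Nodup ∧ (∀ x, x ∈ l ↔ x ∈ S) ∧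
      ∀ x ∈ S, ∀ y ∈ S, F.Adj x y → [x, y] <:+: l ∨ [y, x] <:+: l := by
  induction h : S.card generalizing S with
  | zero =>
    rw [Finset.card_eq_zero] at h
    subst h
    exact ⟨[], by simp⟩
  | succ m ih =>
    have hS : S.Nonempty := Finset.card_pos.1 (by omega)
    obtain ⟨⟨v, hvS⟩, hv⟩ : ∃ v : (S : Set V), ∀ x y : (S : Set V), (F.induce (S : Set V)).Adj v x →
        (F.induce (S : Set V)).Adj v y → x = y := by
      have : Nonempty (S : Set V) := hS.to_subtype
      exact exists_degree_le_one_of_isAcyclic (hF.1.induce (S : Set V))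
    rw [Finset.mem_coe] at hvS
    have hv' : ∀ x ∈ S, ∀ y ∈ S, F.Adj v x → F.Adj v y → x = y := fun x hx y hy h1 h2 =>
      congrArg Subtype.val (hv ⟨x, hx⟩ ⟨y, hy⟩ h1 h2)
    obtain ⟨l, hl, hlS, hlF⟩ := ih (S.erase v) (by rw [Finset.card_erase_of_mem hvS]; omega)
    have hvl : v ∉ l := by simp [hlS]
    -- It is enough to find a place for `v` that is next to its only possible neighbour and does not
    -- separate two consecutive `F`-adjacent vertices.
    suffices H : ∃ s t : List V, l = s ++ t ∧
        (∀ x ∈ S, F.Adj v x → [x, v] <:+: s ++ v :: t ∨ [v, x] <:+: s ++ v :: t) ∧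
        (∀ s' t' x y, s = s' ++ [x] → t = y :: t' → ¬ F.Adj x y) by
      obtain ⟨s, t, rfl, h1, h2⟩ := H
      have key : ∀ x y, F.Adj x y → [x, y] <:+: s ++ t → [x, y] <:+: s ++ v :: t := by
        intro x y hxy hi
        rw [pair_infix_append] at hi ⊢
        rcases hi with hi | hi | ⟨s', t', hs, ht⟩
        · exact Or.inl hi
        · exact Or.inr (Or.inl (List.infix_cons hi))
        · exact absurd hxy (h2 s' t' x y hs ht)
      refine ⟨s ++ v :: t, ?_, fun x => ?_, fun x hx y hy hxy => ?_⟩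
      · rw [List.nodup_middle, List.nodup_cons]
        exact ⟨hvl, hl⟩
      · have := hlS x
        rw [List.mem_append, Finset.mem_erase] at this
        rw [List.mem_append, List.mem_cons]
        by_cases hxv : x = v
        · simp [hxv, hvS]
        · tauto
      · by_cases hxv : x = v
        · subst hxv
          exact (h1 y hy hxy).symm
        by_cases hyv : y = v
        · subst hyv
          exact h1 x hx hxy.symm
        · exact (hlF x (by simp [*]) y (by simp [*]) hxy).imp (key x y hxy) (key y x hxy.symm)
    by_cases hw : ∃ w ∈ S, F.Adj v w
    · obtain ⟨w, hwS, hvw⟩ := hw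
      obtain ⟨a, b, rfl⟩ := List.append_of_mem ((hlS w).2 (Finset.mem_erase.2 ⟨hvw.ne', hwS⟩))
      -- If the predecessor of `w` is an `F`-neighbour, the successor cannot be one, as `w` would
      -- have three neighbours; then `v` goes after `w`, and otherwise before it.
      by_cases hc : ∃ a' c, a = a' ++ [c] ∧ F.Adj c w
      · obtain ⟨a', c, rfl, hcw⟩ := hc
        refine ⟨a' ++ [c] ++ [w], b, by simp, fun x hx hvx => Or.inl ?_, ?_⟩
        · rw [hv' x hx w hwS hvx hvw]
          exact ⟨a' ++ [c], b, by simp⟩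
        · intro s' t' x y hs ht hxy
          obtain ⟨-, hx⟩ := List.append_inj' hs rfl
          simp only [List.cons.injEq, and_true] at hx
          subst hx ht
          have h3 : ({c, y, v} : Set V).ncard = 3 := by
            rw [Set.ncard_eq_three]
            refine ⟨c, y, v, ?_, ?_, ?_, rfl⟩
            · rintro rfl
              simp [List.nodup_append] at hl
            · rintro rfl
              simp at hvl
            · rintro rfl
              simp at hvl
          have h4 := Set.ncard_le_ncard (s := {c, y, v}) (t := F.neighborSet w) (by
            rintro z (rfl | rfl | rfl)
            · exact hcw.symm
            · exact hxy
            · exact hvw.symm) (Set.toFinite _)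
          have := hF.2 w
          omega
      · refine ⟨a, w :: b, rfl, fun x hx hvx => Or.inr ?_, ?_⟩
        · rw [hv' x hx w hwS hvx hvw]
          exact ⟨a, b, by simp⟩
        · intro s' t' x y hs ht hxy
          simp only [List.cons.injEq] at ht
          exact hc ⟨s', x, hs, ht.1 ▸ hxy⟩
    · exact ⟨[], l, rfl, fun x hx hvx => absurd ⟨x, hx, hvx⟩ hw, fun s' t' x y h => by simp at h⟩

/-- In a complete graph every linear forest is contained in a Hamilton cycle. -/
lemma hamThrough_top {V : Type*} [Fintype V] [DecidableEq V] (hV : 3 ≤ Fintype.card V)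
    {F : SimpleGraph V} (hF : IsLinearForest F) : HamThrough (⊤ : SimpleGraph V) F.edgeSet := by
  obtain ⟨l, hl, hlS, hlF⟩ := hF.exists_list Finset.univ
  have hne : l ≠ [] := by
    rintro rfl
    have : Nonempty V := Fintype.card_pos_iff.1 (by omega)
    simpa using (hlS (Classical.arbitrary V)).2 (Finset.mem_univ _)
  have hc : l.IsChain (⊤ : SimpleGraph V).Adj := by
    refine (List.Pairwise.imp ?_ hl).isChain
    intro a b hab
    exact hab
  have hs := Walk.support_ofSupport hne hc
  generalize Walk.ofSupport l hne hc = q at hs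
  have hq : q.IsHamiltonian := by
    intro v
    rw [hs]
    exact List.count_eq_one_of_mem hl ((hlS v).2 (Finset.mem_univ v))
  have hadj : (⊤ : SimpleGraph V).Adj (l.getLast hne) (l.head hne) := by
    intro h
    have h1 := hq.length_eq
    have h2 : q.length = 0 := by
      have := hq.isPath
      generalize hu : l.head hne = u at *
      generalize hv : l.getLast hne = v at *
      subst h
      rw [Walk.isPath_iff_nil] at this
      exact Walk.length_eq_zero_iff.2 this
    omega
  refine ⟨_, _, isHamiltonianCycle_cons hq hadj hV, fun e he => ?_⟩
  induction e with
  | _ x y =>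
    rw [Walk.edges_cons, List.mem_cons]
    right
    rw [← Walk.infix_support_iff_mem_edges, hs]
    exact hlF x (Finset.mem_univ _) y (Finset.mem_univ _) he

lemma isLinearForest_bot {V : Type*} [Fintype V] [DecidableEq V] :
    IsLinearForest (⊥ : SimpleGraph V) :=
  ⟨isAcyclic_bot, fun v => by simp [neighborSet]⟩

/-- A counting obstruction to Hamilton cycles through given edges. -/
lemma not_hamThrough {V : Type*} [Fintype V] [DecidableEq V] {H : SimpleGraph V} {A I : Finset V}
    {F : Set (Sym2 V)} (hI : ∀ x ∈ I, ∀ y, H.Adj x y → y ∈ A) (hAI : Disjoint A I) {w : V}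
    (hwA : w ∉ A) (hwI : w ∉ I) (hne : I.Nonempty) (hF : ∀ x y, s(x, y) ∈ F → x ∈ A)
    (hcard : A.card ≤ I.card + F.ncard) : ¬ HamThrough H F := by
  classical
  rintro ⟨a, p, hp, hFp⟩
  have hcount := (Walk.isHamiltonianCycle_iff_isCycle_and_support_count_tail_eq_one.1 hp).2
  have hsnd : ∀ v, (p.darts.map (·.snd)).count v = 1 := fun v => by
    rw [Walk.map_snd_darts]; exact hcount v
  have hfst : ∀ v, (p.darts.map (·.fst)).count v = 1 := fun v => by
    rw [Walk.map_fst_darts, ← p.tail_support_perm_dropLast_support.count_eq]; exact hcount v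
  obtain ⟨x, hx⟩ := hne
  obtain ⟨d, hd, hd1, hd2⟩ : ∃ d ∈ p.darts, d.fst ∈ A ∪ I ∧ d.snd ∉ A ∪ I := by
    have hxp := hp.mem_support x
    have hw : w ∈ (p.rotate x hxp).support := (hp.rotate hxp).mem_support w
    obtain ⟨d, hd, h1, h2⟩ := ((p.rotate x hxp).takeUntil w hw).exists_boundary_dart
      (A ∪ I : Finset V) (by simp [hx]) (by simp [hwA, hwI])
    exact ⟨d, (p.rotate_darts x hxp).mem_iff.1 (Walk.darts_takeUntil_subset_darts _ hw hd), h1, h2⟩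
  rw [Finset.mem_union, not_or] at hd2
  have hd1 : d.fst ∈ A := (Finset.mem_union.1 hd1).resolve_right fun h =>
    hd2.1 (hI _ h _ d.adj)
  set D := p.darts.toFinset
  have h1 : (D.filter fun d => d.fst ∈ A).card ≤ A.card := by
    refine Finset.card_le_card_of_injOn (fun d => d.fst) (fun d h => ?_) ?_
    · exact (Finset.mem_filter.1 h).2
    · intro d hd d' hd' h
      have hnd : (p.darts.map (·.fst)).Nodup := List.nodup_iff_count_le_one.2 fun v => (hfst v).le
      exact List.inj_on_of_nodup_map hnd
        (List.mem_toFinset.1 (Finset.mem_filter.1 hd).1)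
        (List.mem_toFinset.1 (Finset.mem_filter.1 hd').1) h
  have h2 : I.card ≤ (D.filter fun d => d.snd ∈ I).card := by
    refine Finset.card_le_card_of_surjOn (fun d => d.snd) fun v hv => ?_
    have : v ∈ p.darts.map (·.snd) := List.count_pos_iff.1 (by rw [hsnd]; exact one_pos)
    obtain ⟨d, hd, rfl⟩ := List.mem_map.1 this
    exact ⟨d, by simpa [D] using ⟨hd, hv⟩, rfl⟩
  have h3 : F.ncard ≤ (D.filter fun d => d.edge ∈ F).card := by
    have : F ⊆ ((D.filter fun d => d.edge ∈ F).image (·.edge) : Finset (Sym2 V)) := by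
      intro e he
      obtain ⟨d, hd, rfl⟩ := List.mem_map.1 (hFp e he)
      simp only [Finset.coe_image, Set.mem_image, Finset.mem_coe, Finset.mem_filter]
      exact ⟨d, ⟨by simpa [D] using hd, he⟩, rfl⟩
    refine (Set.ncard_le_ncard this (Finset.finite_toSet _)).trans ?_
    rw [Set.ncard_coe_finset]
    exact Finset.card_image_le
  have hF' : ∀ d : H.Dart, d.edge ∈ F → d.fst ∈ A ∧ d.snd ∈ A := fun d hd =>
    ⟨hF d.fst d.snd hd, hF d.snd d.fst (by rw [Sym2.eq_swap]; exact hd)⟩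
  -- Steps of the cycle entering `I` and steps along `F` all start in `A`; they are disjoint
  -- classes, since `F` lies inside `A`. The step `d` leaving `A ∪ I` is one more, so `|I| + |F| + 1
  -- ≤ |A|`.
  have h4 : insert d ((D.filter fun d => d.snd ∈ I) ∪ D.filter fun d => d.edge ∈ F) ⊆
      D.filter fun d => d.fst ∈ A := by
    intro d' hd'
    simp only [Finset.mem_insert, Finset.mem_union, Finset.mem_filter] at hd' ⊢
    rcases hd' with rfl | ⟨h, h'⟩ | ⟨h, h'⟩
    · exact ⟨by simpa [D] using hd, hd1⟩
    · exact ⟨h, hI _ h' _ d'.adj.symm⟩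
    · exact ⟨h, (hF' d' h').1⟩
  have h5 := Finset.card_le_card h4
  rw [Finset.card_insert_of_notMem, Finset.card_union_of_disjoint] at h5
  · omega
  · rw [Finset.disjoint_filter]
    intro d' _ h h'
    exact Finset.disjoint_left.1 hAI (hF' d' h').2 h
  · simp only [Finset.mem_union, Finset.mem_filter, not_or, not_and]
    exact ⟨fun _ h => hd2.2 h, fun _ h => hd2.1 (hF' d h).2⟩

/-- The set `I` is independent, has only neighbours in the clique `A`, which has `ℓ` vertices more
than `I`, and there is a further vertex. -/
structure IsBarrier {V : Type*} (H : SimpleGraph V) (ℓ : ℤ) (A I : Finset V) : Prop where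
  disjoint : Disjoint A I
  nonempty : I.Nonempty
  card_eq : (A.card : ℤ) = I.card + ℓ
  exists_notMem : ∃ w, w ∉ A ∧ w ∉ I
  mem_of_adj : ∀ x ∈ I, ∀ y, H.Adj x y → y ∈ A
  adj : ∀ x ∈ A, ∀ y ∈ A, x ≠ y → H.Adj x y

/-- The features of a Hamilton-type property on which the bound for stars rests. -/
structure IsHamiltonLike {V : Type*} [Fintype V] (P : SimpleGraph V → Prop) (ℓ : ℤ) : Prop where
  of_sup_edge : ∀ (G : SimpleGraph V) [DecidableRel G.Adj] (u v : V), u ≠ v →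
    (Fintype.card V : ℤ) + ℓ ≤ G.degree u + G.degree v → P (G ⊔ edge u v) → P G
  top : P ⊤
  not_of_isBarrier : ∀ (H : SimpleGraph V) (A I : Finset V), IsBarrier H ℓ A I → ¬ P H

lemma IsBarrier.not_hamThrough {V : Type*} [Fintype V] [DecidableEq V] {H : SimpleGraph V} {ℓ : ℤ}
    {A I : Finset V} (h : IsBarrier H ℓ A I) {F : Set (Sym2 V)}
    (hF : ∀ x y, s(x, y) ∈ F → x ∈ A) (hℓ : ℓ ≤ F.ncard) : ¬ HamThrough H F := by
  obtain ⟨w, hw, hw'⟩ := h.exists_notMem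
  refine StarsForbidden.not_hamThrough h.mem_of_adj h.disjoint hw hw' h.nonempty hF ?_
  have := h.card_eq
  omega

/-! ### Hamiltonian graphs -/

/-- Nontriviality matters because `IsHamiltonian` holds by convention for a one-vertex graph. -/
lemma isHamiltonian_iff_hamThrough {V : Type*} [Fintype V] [DecidableEq V] [Nontrivial V]
    {G : SimpleGraph V} : G.IsHamiltonian ↔ HamThrough G ∅ := by
  constructor
  · intro h
    obtain ⟨a, p, hp⟩ := h Fintype.one_lt_card.ne'
    exact ⟨a, p, hp, by simp⟩
  · rintro ⟨a, p, hp, -⟩ -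
    exact ⟨a, p, hp⟩

lemma isHamiltonian_of_sup_edge {V : Type*} [Fintype V] [DecidableEq V] {G : SimpleGraph V}
    [DecidableRel G.Adj] {u v : V} (hdeg : Fintype.card V ≤ G.degree u + G.degree v)
    (h : (G ⊔ edge u v).IsHamiltonian) : G.IsHamiltonian := by
  intro hV
  have : Nontrivial V := by
    rw [← Fintype.one_lt_card_iff_nontrivial]
    have : 0 < Fintype.card V := Fintype.card_pos_iff.2 ⟨u⟩
    omega
  rw [isHamiltonian_iff_hamThrough] at h
  exact isHamiltonian_iff_hamThrough.2
    (h.of_sup_edge (k := 0) (Set.empty_subset _) (by simp) hdeg) hV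

lemma isHamiltonian_top {V : Type*} [Fintype V] [DecidableEq V] (hV : 3 ≤ Fintype.card V) :
    (⊤ : SimpleGraph V).IsHamiltonian := by
  have : Nontrivial V := Fintype.one_lt_card_iff_nontrivial.1 (by omega)
  rw [isHamiltonian_iff_hamThrough]
  simpa using hamThrough_top hV isLinearForest_bot

lemma IsBarrier.not_isHamiltonian {V : Type*} [Fintype V] [DecidableEq V] {H : SimpleGraph V}
    {A I : Finset V} (h : IsBarrier H 0 A I) : ¬ H.IsHamiltonian := by
  obtain ⟨w, -, hw⟩ := h.exists_notMem
  obtain ⟨x, hx⟩ := h.nonempty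
  have : Nontrivial V := ⟨x, w, fun h => hw (h ▸ hx)⟩
  rw [isHamiltonian_iff_hamThrough]
  exact h.not_hamThrough (by simp) (by simp)

lemma isHamiltonLike_isHamiltonian {V : Type*} [Fintype V] [DecidableEq V]
    (hV : 3 ≤ Fintype.card V) : IsHamiltonLike (V := V) SimpleGraph.IsHamiltonian 0 where
  of_sup_edge G _ u v _ hdeg h := isHamiltonian_of_sup_edge (by omega) h
  top := isHamiltonian_top hV
  not_of_isBarrier _ _ _ h := h.not_isHamiltonian

/-! ### Traceable graphs -/

/-- The graph obtained from `G` by adding a vertex adjacent to all others. -/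
def cone {V : Type*} (G : SimpleGraph V) : SimpleGraph (Option V) where
  Adj x y := x ≠ y ∧ ∀ a b, x = some a → y = some b → G.Adj a b
  symm := ⟨fun _ _ h => ⟨h.1.symm, fun a b ha hb => (h.2 b a hb ha).symm⟩⟩
  loopless := ⟨fun _ h => h.1 rfl⟩

lemma cone_adj_some {V : Type*} {G : SimpleGraph V} {a b : V} :
    (cone G).Adj (some a) (some b) ↔ G.Adj a b := by
  constructor
  · exact fun h => h.2 a b rfl rfl
  · intro h
    refine ⟨fun h' => h.ne (Option.some.inj h'), ?_⟩
    rintro a b ⟨rfl⟩ ⟨rfl⟩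
    exact h

lemma cone_adj_none {V : Type*} {G : SimpleGraph V} {a : V} : (cone G).Adj none (some a) :=
  ⟨by simp, by simp⟩

lemma exists_walk_of_cone {V : Type*} {G : SimpleGraph V} {x y : Option V} (p : (cone G).Walk x y)
    (hp : none ∉ p.support) (u v : V) (hu : x = some u) (hv : y = some v) :
    ∃ q : G.Walk u v, q.support.map some = p.support := by
  induction p generalizing u with
  | nil =>
    obtain rfl : u = v := Option.some.inj (hu ▸ hv)
    exact ⟨Walk.nil, by simp [hu]⟩
  | @cons x z y h p ih =>
    rw [Walk.support_cons, List.mem_cons, not_or] at hp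
    cases z with
    | none => exact absurd p.start_mem_support hp.2
    | some w =>
      subst hu
      obtain ⟨q, hq⟩ := ih hp.2 w rfl hv
      exact ⟨Walk.cons (cone_adj_some.1 h) q, by simp [hq]⟩

/-- A Hamilton path closes up through the apex `none`; conversely, deleting the apex from a Hamilton
cycle leaves a Hamilton path. -/
lemma isTraceable_iff_hamThrough {V : Type*} [Fintype V] [DecidableEq V] {G : SimpleGraph V}
    (hV : 2 ≤ Fintype.card V) : IsTraceable G ↔ HamThrough (cone G) ∅ := by
  have hV' : 3 ≤ Fintype.card (Option V) := by rw [Fintype.card_option]; omega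
  constructor
  · rintro ⟨u, v, p, hp⟩
    let f : G →g cone G := ⟨some, fun h => cone_adj_some.2 h⟩
    have hf : ∀ a, f a = some a := fun _ => rfl
    have hq : (Walk.cons (cone_adj_none (G := G) (a := u)) (p.map f)).IsHamiltonian := by
      refine Walk.IsPath.isHamiltonian_of_mem ?_ fun x => ?_
      · rw [Walk.cons_isPath_iff]
        exact ⟨hp.isPath.map (Option.some_injective V), by simp [hf]⟩
      · cases x with
        | none => simp
        | some x =>
          rw [Walk.support_cons, Walk.support_map]
          exact List.mem_cons_of_mem _ (List.mem_map.2 ⟨x, hp.mem_support x, rfl⟩)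
    exact ⟨_, _, isHamiltonianCycle_cons hq cone_adj_none.symm hV', by simp⟩
  · rintro ⟨a, p, hp, -⟩
    have hq := hp.rotate (hp.mem_support none)
    generalize p.rotate none _ = q at hq
    cases q with
    | nil => exact absurd rfl hq.isCycle.ne_nil
    | @cons _ z _ h q =>
      obtain ⟨r, rfl⟩ : ∃ r : (cone G).Walk none z, q = r.reverse := ⟨q.reverse, by simp⟩
      cases r with
      | nil => exact absurd h (cone G).irrefl
      | @cons _ w _ h' r =>
        have hr := ((Walk.cons_isCycle_iff _ _).1 hq.isCycle).1
        rw [Walk.isPath_reverse_iff, Walk.cons_isPath_iff] at hr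
        cases w with
        | none => exact absurd r.start_mem_support hr.2
        | some w =>
          cases z with
          | none => exact absurd r.end_mem_support hr.2
          | some z =>
            obtain ⟨s, hs⟩ := exists_walk_of_cone r hr.2 w z rfl rfl
            refine ⟨w, z, s, Walk.IsPath.isHamiltonian_of_mem ?_ fun x => ?_⟩
            · have := hr.1.support_nodup
              rw [← hs] at this
              exact Walk.IsPath.mk' (List.Nodup.of_map _ this)
            · have := hq.mem_support (some x)
              have hw : x = w → x ∈ s.support := fun h => h ▸ s.start_mem_support
              simpa [← hs, or_iff_left_of_imp hw] using this

lemma degree_cone_some {V : Type*} [Fintype V] [DecidableEq V] {G : SimpleGraph V}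
    [DecidableRel G.Adj] [DecidableRel (cone G).Adj] (v : V) :
    (cone G).degree (some v) = G.degree v + 1 := by
  have : (cone G).neighborFinset (some v) = insert none ((G.neighborFinset v).map .some) := by
    ext x
    cases x with
    | none => simp [cone_adj_none.symm]
    | some x => simp [cone_adj_some]
  rw [← card_neighborFinset_eq_degree, this, Finset.card_insert_of_notMem (by simp),
    Finset.card_map, card_neighborFinset_eq_degree]

lemma cone_sup_edge {V : Type*} {G : SimpleGraph V} {u v : V} :
    cone (G ⊔ edge u v) = cone G ⊔ edge (some u) (some v) := by
  ext x y
  cases x with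
  | none =>
    cases y with
    | none => simp
    | some y => simp [cone_adj_none]
  | some x =>
    cases y with
    | none => simp [cone_adj_none.symm]
    | some y => simp [cone_adj_some, edge_adj]

lemma cone_top {V : Type*} : cone (⊤ : SimpleGraph V) = ⊤ := by
  ext x y
  constructor
  · exact fun h => h.ne
  · rintro h
    refine ⟨h, ?_⟩
    rintro a b rfl rfl
    exact fun h' => h (congrArg some h')

/-- The apex joins the clique side, which turns the excess `-1` of traceability into the excess `0`
of Hamiltonicity. -/
lemma IsBarrier.cone {V : Type*} [DecidableEq V] {H : SimpleGraph V} {ℓ : ℤ} {A I : Finset V}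
    (h : IsBarrier H ℓ A I) :
    IsBarrier (cone H) (ℓ + 1) (insert none (A.map .some)) (I.map .some) where
  disjoint := by
    rw [Finset.disjoint_insert_left]
    exact ⟨by simp, (Finset.disjoint_map _).2 h.disjoint⟩
  nonempty := h.nonempty.map
  card_eq := by
    rw [Finset.card_insert_of_notMem (by simp), Finset.card_map, Finset.card_map]
    have := h.card_eq
    push_cast
    omega
  exists_notMem := by
    obtain ⟨w, hw⟩ := h.exists_notMem
    exact ⟨some w, by simpa using hw⟩
  mem_of_adj := by
    intro x hx y hxy
    obtain ⟨x, hx', rfl⟩ := Finset.mem_map.1 hx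
    cases y with
    | none => simp
    | some y => simpa using h.mem_of_adj x hx' y (cone_adj_some.1 hxy)
  adj := by
    intro x hx y hy hxy
    refine ⟨hxy, ?_⟩
    rintro a b rfl rfl
    exact h.adj a (by simpa using hx) b (by simpa using hy) fun h' => hxy (congrArg some h')

lemma isHamiltonLike_isTraceable {V : Type*} [Fintype V] [DecidableEq V]
    (hV : 2 ≤ Fintype.card V) : IsHamiltonLike (V := V) IsTraceable (-1) where
  of_sup_edge G _ u v huv hdeg h := by
    classical
    rw [isTraceable_iff_hamThrough hV] at h ⊢
    rw [cone_sup_edge] at h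
    -- In the cone both degrees and the order grow by one, so a degree sum of at least `n - 1`
    -- becomes one of at least `n + 1`.
    refine h.of_sup_edge (k := 0) (Set.empty_subset _) (by simp) ?_
    rw [degree_cone_some, degree_cone_some, Fintype.card_option]
    omega
  top := by
    rw [isTraceable_iff_hamThrough hV, cone_top]
    simpa using hamThrough_top (by rw [Fintype.card_option]; omega) isLinearForest_bot
  not_of_isBarrier H A I h := by
    rw [isTraceable_iff_hamThrough hV]
    exact h.cone.not_hamThrough (by simp) (by simp)

/-! ### Hamiltonian-connected graphs -/

/-- The closing edge `uv` need not belong to `G`, hence it is added and then required to be used. -/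
lemma exists_path_iff_hamThrough {V : Type*} [Fintype V] [DecidableEq V] {G : SimpleGraph V}
    (hV : 3 ≤ Fintype.card V) {u v : V} (huv : u ≠ v) :
    (∃ p : G.Walk u v, p.IsHamiltonian) ↔ HamThrough (G ⊔ edge u v) {s(u, v)} := by
  constructor
  · rintro ⟨p, hp⟩
    have h : (G ⊔ edge u v).Adj v u := by
      rw [sup_adj, edge_adj]
      exact Or.inr ⟨Or.inr ⟨rfl, rfl⟩, huv.symm⟩
    have hq : (p.map (Hom.ofLE le_sup_left : G →g G ⊔ edge u v)).IsHamiltonian :=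
      hp.map _ Function.bijective_id
    refine ⟨_, _, isHamiltonianCycle_cons hq h hV, ?_⟩
    rintro e rfl
    simp [Sym2.eq_swap]
  · rintro ⟨a, p, hp, hF⟩
    obtain ⟨q, hq, -⟩ := exists_path_of_mem_edges hp (hF _ rfl)
    refine ⟨q.reverse, fun x => ?_⟩
    simpa using hq x

lemma isLinearForest_edge {V : Type*} [Fintype V] [DecidableEq V] (u v : V) :
    IsLinearForest (edge u v) := by
  constructor
  · by_cases huv : u = v
    · subst huv
      rw [edge_self_eq_bot]
      exact isAcyclic_bot
    · have := IsAcyclic.sup_edge_of_not_reachable (G := (⊥ : SimpleGraph V)) (u := u) (v := v)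
        (by simpa using huv) isAcyclic_bot
      rwa [bot_sup_eq] at this
  · intro x
    refine (Set.ncard_le_ncard (t := {u, v}) ?_ (Set.toFinite _)).trans ?_
    · intro y hy
      rw [mem_neighborSet, edge_adj] at hy
      rcases hy.1 with ⟨-, rfl⟩ | ⟨-, rfl⟩ <;> simp
    · exact (Set.ncard_insert_le u {v}).trans (by simp)

lemma edgeSet_edge_of_ne {V : Type*} {u v : V} (huv : u ≠ v) :
    (edge u v).edgeSet = {s(u, v)} := by
  ext e
  induction e with
  | _ x y =>
    rw [mem_edgeSet, edge_adj, Set.mem_singleton_iff, Sym2.eq_iff]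
    constructor
    · exact fun h => h.1
    · rintro (⟨rfl, rfl⟩ | ⟨rfl, rfl⟩)
      · exact ⟨Or.inl ⟨rfl, rfl⟩, huv⟩
      · exact ⟨Or.inr ⟨rfl, rfl⟩, huv.symm⟩

lemma IsBarrier.sup_edge {V : Type*} {H : SimpleGraph V} {ℓ : ℤ} {A I : Finset V}
    (h : IsBarrier H ℓ A I) {u v : V} (hu : u ∈ A) (hv : v ∈ A) :
    IsBarrier (H ⊔ edge u v) ℓ A I where
  disjoint := h.disjoint
  nonempty := h.nonempty
  card_eq := h.card_eq
  exists_notMem := h.exists_notMem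
  mem_of_adj x hx y hxy := by
    rw [sup_adj, edge_adj] at hxy
    rcases hxy with hxy | ⟨⟨rfl, rfl⟩ | ⟨rfl, rfl⟩, -⟩
    · exact h.mem_of_adj x hx y hxy
    · exact hv
    · exact hu
  adj x hx y hy hxy := Or.inl (h.adj x hx y hy hxy)

lemma isHamiltonLike_isHamiltonianConnected {V : Type*} [Fintype V] [DecidableEq V]
    (hV : 3 ≤ Fintype.card V) : IsHamiltonLike (V := V) IsHamiltonianConnected 1 where
  of_sup_edge G _ x y hxy hdeg h u v huv := by
    classical
    have h := h u v huv
    rw [exists_path_iff_hamThrough hV huv] at h ⊢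
    rw [sup_right_comm] at h
    refine h.of_sup_edge (k := 1) ?_ (by simp) ?_
    · rw [edgeSet_sup, edgeSet_edge_of_ne huv]
      exact Set.subset_union_right
    · have h1 := degree_le_of_le (v := x) (le_sup_left : G ≤ G ⊔ edge u v)
      have h2 := degree_le_of_le (v := y) (le_sup_left : G ≤ G ⊔ edge u v)
      omega
  top u v huv := by
    rw [exists_path_iff_hamThrough hV huv, top_sup_eq, ← edgeSet_edge_of_ne huv]
    exact hamThrough_top hV (isLinearForest_edge u v)
  not_of_isBarrier H A I h hH := by
    have h1 := h.card_eq
    have h2 := h.nonempty.card_pos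
    obtain ⟨u, hu, v, hv, huv⟩ := Finset.one_lt_card.1 (show 1 < A.card by omega)
    have := hH u v huv
    rw [exists_path_iff_hamThrough hV huv] at this
    refine (h.sup_edge hu hv).not_hamThrough ?_ (by simp) this
    intro x y hxy
    rcases Sym2.eq_iff.1 hxy with ⟨rfl, -⟩ | ⟨rfl, -⟩
    · exact hu
    · exact hv

/-! ### Edge-Hamiltonian graphs -/

/-- A path through the vertices of a list. -/
lemma exists_isLinearForest_of_list {V : Type*} [Fintype V] [DecidableEq V] (a : V) (l : List V)
    (hl : (a :: l).Nodup) : ∃ F : SimpleGraph V, IsLinearForest F ∧ F.edgeSet.ncard = l.length ∧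
      (∀ x y, F.Adj x y → x ∈ a :: l) ∧ (F.neighborSet a).ncard ≤ 1 := by
  -- The bound on the neighbours of the end `a` is the invariant that leaves room for the next edge.
  induction l generalizing a with
  | nil => exact ⟨⊥, isLinearForest_bot, by simp, by simp, by simp [neighborSet]⟩
  | cons b l ih =>
    rw [List.nodup_cons] at hl
    obtain ⟨F, hF, hcard, hsupp, hb⟩ := ih b hl.2
    have hab : a ≠ b := by
      rintro rfl
      simp at hl
    have ha : ∀ y, ¬ F.Adj a y := fun y h => hl.1 (hsupp a y h)
    have hnb : ∀ x, (F ⊔ edge a b).neighborSet x =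
        F.neighborSet x ∪ (edge a b).neighborSet x := fun x => rfl
    have hnu : ∀ x, (edge a b).neighborSet x ⊆ {if x = a then b else a} := by
      intro x y hy
      rw [mem_neighborSet, edge_adj] at hy
      rcases hy.1 with ⟨rfl, rfl⟩ | ⟨rfl, rfl⟩ <;> simp [hab.symm]
    have hnu' : ∀ x, ((edge a b).neighborSet x).ncard ≤ 1 := fun x =>
      (Set.ncard_le_ncard (hnu x) (Set.toFinite _)).trans (by simp)
    have hFa : F.neighborSet a = ∅ := by
      ext y
      simpa using ha y
    refine ⟨F ⊔ edge a b, ⟨IsAcyclic.sup_edge_of_not_reachable ?_ hF.1, fun x => ?_⟩, ?_, ?_, ?_⟩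
    · rintro ⟨p⟩
      cases p with
      | nil => exact hab rfl
      | cons h _ => exact ha _ h
    · rw [hnb]
      refine (Set.ncard_union_le _ _).trans ?_
      by_cases hx : x = a
      · subst hx
        have := hnu' x
        rw [hFa, Set.ncard_empty]
        omega
      by_cases hx' : x = b
      · subst hx'
        have := hnu' x
        omega
      · have : (edge a b).neighborSet x = ∅ := by
          ext y
          simp [edge_adj, hx, hx']
        rw [this, Set.ncard_empty]
        exact hF.2 x
    · rw [edgeSet_sup, edgeSet_edge_of_ne hab, Set.union_singleton,
        Set.ncard_insert_of_notMem (show s(a, b) ∉ F.edgeSet from ha b) (Set.toFinite _), hcard,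
        List.length_cons]
    · intro x y hxy
      rw [sup_adj, edge_adj] at hxy
      rcases hxy with hxy | ⟨⟨rfl, -⟩ | ⟨rfl, -⟩, -⟩
      · exact List.mem_cons_of_mem _ (hsupp x y hxy)
      · simp
      · simp
    · rw [hnb, hFa, Set.empty_union]
      exact hnu' a

lemma isHamiltonLike_isEdgeHamiltonian {V : Type*} [Fintype V] [DecidableEq V] {k : ℕ}
    (hV : 3 ≤ Fintype.card V) : IsHamiltonLike (V := V) (IsEdgeHamiltonian k) k where
  of_sup_edge G _ x y _ hdeg h F hFG hF hFk :=
    HamThrough.of_sup_edge (edgeSet_subset_edgeSet.2 hFG) hFk (by omega)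
      (h F (hFG.trans le_sup_left) hF hFk)
  top F _ hF _ := hamThrough_top hV hF
  not_of_isBarrier H A I h hH := by
    have h1 := h.card_eq
    have h2 := h.nonempty.card_pos
    -- A path on `k + 1` vertices of the clique `A` is a linear forest with `k` edges that no
    -- Hamilton cycle can contain.
    obtain ⟨S, hSA, hS⟩ := Finset.exists_subset_card_eq (show k + 1 ≤ A.card by omega)
    have hl : S.toList.length = k + 1 := by rw [Finset.length_toList, hS]
    have hnd := S.nodup_toList
    have hmem : ∀ x ∈ S.toList, x ∈ A := fun x hx => hSA (Finset.mem_toList.1 hx)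
    generalize S.toList = l at hl hnd hmem
    cases l with
    | nil => simp at hl
    | cons a l =>
      obtain ⟨F, hF, hcard, hsupp, -⟩ := exists_isLinearForest_of_list a l hnd
      have hl : l.length = k := by simpa using hl
      refine h.not_hamThrough (F := F.edgeSet) (fun x y hxy => hmem x (hsupp x y hxy)) (by omega)
        (hH F (fun x y hxy => ?_) hF (by omega))
      exact h.adj x (hmem x (hsupp x y hxy)) y (hmem y (hsupp y x hxy.symm)) hxy.ne

/-! ### `k`-Hamiltonian graphs -/

lemma induce_sup_edge {V : Type*} {G : SimpleGraph V} {s : Set V} {u v : V} (hu : u ∈ s)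
    (hv : v ∈ s) : (G ⊔ edge u v).induce s = G.induce s ⊔ edge ⟨u, hu⟩ ⟨v, hv⟩ := by
  ext ⟨x, hx⟩ ⟨y, hy⟩
  simp [edge_adj]

lemma induce_sup_edge_of_notMem {V : Type*} {G : SimpleGraph V} {s : Set V} {u v : V}
    (h : u ∉ s ∨ v ∉ s) : (G ⊔ edge u v).induce s = G.induce s := by
  ext ⟨x, hx⟩ ⟨y, hy⟩
  simp only [comap_adj, Function.Embedding.subtype_apply, sup_adj, edge_adj, or_iff_left_iff_imp]
  rintro ⟨⟨rfl, rfl⟩ | ⟨rfl, rfl⟩, -⟩ <;> tauto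

lemma degree_le_degree_induce_compl {V : Type*} [Fintype V] [DecidableEq V] {G : SimpleGraph V}
    [DecidableRel G.Adj] (S : Finset V) (v : ((Sᶜ : Finset V) : Set V))
    [DecidableRel (G.induce ((Sᶜ : Finset V) : Set V)).Adj] :
    G.degree v ≤ (G.induce ((Sᶜ : Finset V) : Set V)).degree v + S.card := by
  rw [← card_neighborFinset_eq_degree, ← card_neighborFinset_eq_degree,
    ← Finset.card_map (Function.Embedding.subtype _)]
  refine (Finset.card_le_card ?_).trans (Finset.card_union_le _ _)
  intro w hw
  by_cases hwS : w ∈ S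
  · simp [hwS]
  · rw [mem_neighborFinset] at hw
    simp [hwS, hw]

/-- Deleting `k` vertices of `A` from a barrier of excess `k` leaves one of excess `0`, an
obstruction to Hamiltonicity. -/
lemma IsBarrier.induce {V : Type*} [Fintype V] [DecidableEq V] {H : SimpleGraph V} {ℓ : ℤ}
    {A I S : Finset V} (h : IsBarrier H ℓ A I) (hS : S ⊆ A) :
    IsBarrier (H.induce ((Sᶜ : Finset V) : Set V)) (ℓ - S.card)
      (A.subtype (· ∈ ((Sᶜ : Finset V) : Set V))) (I.subtype (· ∈ ((Sᶜ : Finset V) : Set V))) where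
  disjoint := by
    rw [Finset.disjoint_left]
    intro x hx hx'
    rw [Finset.mem_subtype] at hx hx'
    exact Finset.disjoint_left.1 h.disjoint hx hx'
  nonempty := by
    obtain ⟨x, hx⟩ := h.nonempty
    exact ⟨⟨x, by simpa using fun hxS => Finset.disjoint_left.1 h.disjoint (hS hxS) hx⟩,
      by simpa using hx⟩
  card_eq := by
    have h1 : I.filter (· ∈ ((Sᶜ : Finset V) : Set V)) = I := by
      rw [Finset.filter_eq_self]
      intro x hx
      simpa using fun hxS => Finset.disjoint_left.1 h.disjoint (hS hxS) hx
    have h2 : A.filter (· ∈ ((Sᶜ : Finset V) : Set V)) = A \ S := by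
      ext x
      simp
    rw [Finset.card_subtype, Finset.card_subtype, h1, h2]
    have := h.card_eq
    have := Finset.card_sdiff_add_card_eq_card hS
    omega
  exists_notMem := by
    obtain ⟨w, hw, hw'⟩ := h.exists_notMem
    exact ⟨⟨w, by simpa using fun hwS => hw (hS hwS)⟩, by simpa using hw, by simpa using hw'⟩
  mem_of_adj x hx y hxy := by
    rw [Finset.mem_subtype] at hx ⊢
    exact h.mem_of_adj x hx y hxy
  adj x hx y hy hxy := by
    rw [Finset.mem_subtype] at hx hy
    exact h.adj x hx y hy fun h' => hxy (Subtype.ext h')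

lemma isHamiltonLike_isKHamiltonian {V : Type*} [Fintype V] [DecidableEq V] {k : ℕ}
    (hV : k + 3 ≤ Fintype.card V) : IsHamiltonLike (V := V) (IsKHamiltonian k) k where
  of_sup_edge G _ x y _ hdeg h S hS := by
    classical
    have h := h S hS
    by_cases hxy : x ∈ ((Sᶜ : Finset V) : Set V) ∧ y ∈ ((Sᶜ : Finset V) : Set V)
    · rw [induce_sup_edge hxy.1 hxy.2] at h
      -- Each degree drops by at most `|S| ≤ k`, so the sum is still at least `n + k - 2|S| ≥ n -
      -- |S|`.
      refine isHamiltonian_of_sup_edge ?_ h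
      have h1 := degree_le_degree_induce_compl (G := G) S ⟨x, hxy.1⟩
      have h2 := degree_le_degree_induce_compl (G := G) S ⟨y, hxy.2⟩
      dsimp only at h1 h2
      have h3 := Finset.card_add_card_compl S
      have h4 : Fintype.card ((Sᶜ : Finset V) : Set V) = Sᶜ.card := Fintype.card_coe _
      omega
    · rwa [induce_sup_edge_of_notMem (by tauto)] at h
  top S hS := by
    have : (⊤ : SimpleGraph V).induce ((Sᶜ : Finset V) : Set V) = ⊤ := by
      ext x y
      exact not_congr Subtype.ext_iff.symm
    rw [this]
    refine isHamiltonian_top ?_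
    have h3 := Finset.card_add_card_compl S
    have h4 : Fintype.card ((Sᶜ : Finset V) : Set V) = Sᶜ.card := Fintype.card_coe _
    omega
  not_of_isBarrier H A I h hH := by
    have h1 := h.card_eq
    obtain ⟨S, hSA, hS⟩ := Finset.exists_subset_card_eq (show k ≤ A.card by omega)
    have := h.induce hSA
    rw [hS, sub_self] at this
    exact this.not_isHamiltonian (hH S hS.le)

/-! ### Degree sequences -/

/-- A Chvátal-type condition: a graph without a Hamilton-type property has a supergraph with many
vertices of small degree. -/
lemma IsHamiltonLike.exists_degree_bounds {V : Type*} [Fintype V] [DecidableEq V]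
    {P : SimpleGraph V → Prop} {ℓ : ℤ} (hP : IsHamiltonLike P ℓ) (hℓ : -1 ≤ ℓ)
    (hn : ℓ + 3 ≤ Fintype.card V) {G : SimpleGraph V} (hG : ¬ P G) :
    ∃ (G' : SimpleGraph V) (_ : DecidableRel G'.Adj) (a i : ℕ), G ≤ G' ∧ 1 ≤ i ∧ (a : ℤ) = i + ℓ ∧
      a + i + 1 ≤ Fintype.card V ∧ i ≤ (Finset.univ.filter fun v => G'.degree v ≤ a).card ∧
      Fintype.card V - a ≤
        (Finset.univ.filter fun v => G'.degree v ≤ Fintype.card V - 1 - i).card := by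
  classical
  obtain ⟨G', hGG', hmax⟩ := Finite.exists_le_maximal (p := fun G => ¬ P G) hG
  have hsat : ∀ x y, x ≠ y → ¬ G'.Adj x y →
      (G'.degree x : ℤ) + G'.degree y < Fintype.card V + ℓ := by
    intro x y hxy hadj
    by_contra! hdeg
    refine hmax.prop (hP.of_sup_edge G' x y hxy hdeg ?_)
    by_contra hnot
    have := hmax.le_of_ge hnot le_sup_left
    exact hadj (this (Or.inr (by simp [edge_adj, hxy])))
  have hne : ∃ p : V × V, p.1 ≠ p.2 ∧ ¬ G'.Adj p.1 p.2 := by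
    by_contra! h
    refine hmax.prop ?_
    have : G' = ⊤ := by
      ext x y
      exact ⟨fun h => h.ne, fun hxy => h (x, y) hxy⟩
    exact this ▸ hP.top
  obtain ⟨⟨u, v⟩, huv, hbest⟩ := Finset.exists_max_image
    (Finset.univ.filter fun p : V × V => p.1 ≠ p.2 ∧ ¬ G'.Adj p.1 p.2)
    (fun p => G'.degree p.1 + G'.degree p.2) (by simpa [Finset.filter_nonempty_iff] using hne)
  simp only [Finset.mem_filter, Finset.mem_univ, true_and, Prod.forall, and_imp] at huv hbest
  have key : ∀ u v : V, u ≠ v → ¬ G'.Adj u v → G'.degree u ≤ G'.degree v →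
      (∀ x y, x ≠ y → ¬ G'.Adj x y → G'.degree x + G'.degree y ≤ G'.degree u + G'.degree v) →
      ∃ a i : ℕ, 1 ≤ i ∧ (a : ℤ) = i + ℓ ∧
      a + i + 1 ≤ Fintype.card V ∧ i ≤ (Finset.univ.filter fun v => G'.degree v ≤ a).card ∧
      Fintype.card V - a ≤
        (Finset.univ.filter fun v => G'.degree v ≤ Fintype.card V - 1 - i).card := by
    intro u v huv hadj hle hbest
    have hs := hsat u v huv hadj
    have hnon : ∀ x, (Finset.univ.filter fun w => ¬ G'.Adj x w).card + G'.degree x =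
        Fintype.card V := fun x => by
      rw [← card_neighborFinset_eq_degree, neighborFinset_eq_filter, add_comm,
        Finset.card_filter_add_card_filter_not, Finset.card_univ]
    have hu := hnon u
    have hv := hnon v
    have hsub : ∀ m, G'.degree v ≤ m → (Finset.univ.filter fun w => ¬ G'.Adj u w).card ≤
        (Finset.univ.filter fun w => G'.degree w ≤ m).card := by
      intro m hm
      refine Finset.card_le_card fun w hw => ?_
      simp only [Finset.mem_filter, Finset.mem_univ, true_and] at hw ⊢
      by_cases h : u = w
      · subst h; omega
      · have := hbest u w h hw
        omega
    -- Main case: `a = deg u` and `i = a - ℓ`. By the choice of the pair, the non-neighbours of `v`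
    -- other than `v`, at least `i` of them, have degree at most `deg u`, and the `n - a`
    -- non-neighbours of `u` have degree at most `deg v ≤ n - 1 - i`.
    by_cases hh : ℓ + 1 ≤ G'.degree u
    · obtain ⟨i, hi⟩ : ∃ i : ℕ, (i : ℤ) = G'.degree u - ℓ :=
        ⟨(G'.degree u - ℓ).toNat, Int.toNat_of_nonneg (by omega)⟩
      refine ⟨G'.degree u, i, by omega, by omega, by omega, ?_, ?_⟩
      · have hv' : ((Finset.univ.filter fun w => ¬ G'.Adj v w).erase v).card + 1 =
            (Finset.univ.filter fun w => ¬ G'.Adj v w).card :=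
          Finset.card_erase_add_one (by simp)
        refine le_trans ?_ (Finset.card_le_card
          (s := (Finset.univ.filter fun w => ¬ G'.Adj v w).erase v) fun w hw => ?_)
        · omega
        · simp only [Finset.mem_erase, Finset.mem_filter, Finset.mem_univ, true_and] at hw ⊢
          have := hbest w v hw.1 fun h => hw.2 h.symm
          omega
      · exact le_trans (by omega) (hsub _ (by omega))
    -- Here `deg u ≤ ℓ` and `i = 1` works: `u` itself is the vertex of small degree, and `deg v ≤ n
    -- - 2` because `v` misses `u`.
    · obtain ⟨a, ha⟩ : ∃ a : ℕ, (a : ℤ) = 1 + ℓ := ⟨(1 + ℓ).toNat, Int.toNat_of_nonneg (by omega)⟩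
      refine ⟨a, 1, le_rfl, by simpa using ha, by omega, ?_, ?_⟩
      · refine Finset.card_pos.2 ⟨u, ?_⟩
        simp only [Finset.mem_filter, Finset.mem_univ, true_and]
        omega
      · refine le_trans (by omega) (hsub _ ?_)
        have : 1 < (Finset.univ.filter fun w => ¬ G'.Adj v w).card := by
          rw [Finset.one_lt_card]
          exact ⟨u, by simpa using fun h => hadj h.symm, v, by simp, huv⟩
        omega
  refine ⟨G', inferInstance, ?_⟩
  rcases le_total (G'.degree u) (G'.degree v) with h | h
  · obtain ⟨a, i, H⟩ := key u v huv.1 huv.2 h hbest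
    exact ⟨a, i, hGG', H⟩
  · obtain ⟨a, i, H⟩ := key v u huv.1.symm (fun h => huv.2 h.symm) h fun x y hxy hadj => by
      have := hbest x y hxy hadj
      omega
    exact ⟨a, i, hGG', H⟩

/-- The sum of `deg v` choose `t` in the join of `K_a` with `I_i ∪ K_{n-a-i}`. -/
def starSum (n t a i : ℕ) : ℕ :=
  i * a.choose t + (n - a - i) * (n - 1 - i).choose t + a * (n - 1).choose t

/-- Choose nested sets `A ⊆ B` of sizes `i` and `n - a`; degrees are at most `a` on `A`, `n - 1 - i`
on `B \ A` and `n - 1` elsewhere. Nesting is possible because `a ≤ n - 1 - i`. -/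
lemma sum_choose_degree_le {V : Type*} [Fintype V] [DecidableEq V] {G : SimpleGraph V}
    [DecidableRel G.Adj] (t : ℕ) {a i : ℕ} (hai : a + i + 1 ≤ Fintype.card V)
    (h₁ : i ≤ (Finset.univ.filter fun v => G.degree v ≤ a).card)
    (h₂ : Fintype.card V - a ≤
      (Finset.univ.filter fun v => G.degree v ≤ Fintype.card V - 1 - i).card) :
    ∑ v, (G.degree v).choose t ≤ starSum (Fintype.card V) t a i := by
  obtain ⟨A, hA, hAc⟩ := Finset.exists_subset_card_eq h₁
  obtain ⟨B, hAB, hB, hBc⟩ := Finset.exists_subsuperset_card_eq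
    (s := A) (t := Finset.univ.filter fun v => G.degree v ≤ Fintype.card V - 1 - i)
    (fun v hv => by
      have := hA hv
      simp only [Finset.mem_filter, Finset.mem_univ, true_and] at this ⊢
      omega) (by omega) h₂
  have e1 : ∑ v ∈ A, (G.degree v).choose t ≤ i * a.choose t := by
    rw [← hAc, ← smul_eq_mul]
    exact Finset.sum_le_card_nsmul _ _ _ fun v hv =>
      Nat.choose_le_choose t (Finset.mem_filter.1 (hA hv)).2
  have e2 : ∑ v ∈ B \ A, (G.degree v).choose t ≤
      (Fintype.card V - a - i) * (Fintype.card V - 1 - i).choose t := by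
    rw [← hBc, ← hAc, ← Finset.card_sdiff_of_subset hAB, ← smul_eq_mul, hAc]
    exact Finset.sum_le_card_nsmul _ _ _ fun v hv =>
      Nat.choose_le_choose t (Finset.mem_filter.1 (hB (Finset.mem_sdiff.1 hv).1)).2
  have e3 : ∑ v ∈ Bᶜ, (G.degree v).choose t ≤ a * (Fintype.card V - 1).choose t := by
    have : Bᶜ.card = a := by
      rw [Finset.card_compl]
      omega
    rw [← smul_eq_mul, ← this]
    exact Finset.sum_le_card_nsmul _ _ _ fun v _ =>
      Nat.choose_le_choose t (Nat.le_sub_one_of_lt (G.degree_lt_card_verts v))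
  rw [← Finset.sum_add_sum_compl B, ← Finset.sum_sdiff hAB, starSum]
  omega

/-! ### Convexity -/

/-- By Pascal's rule the differences of `m ↦ m choose (t + 1)` are `m choose t`, which is
nondecreasing in `m`. -/
lemma two_mul_choose_succ_le (m t : ℕ) :
    2 * (m + 1).choose t ≤ m.choose t + (m + 2).choose t := by
  cases t with
  | zero => simp
  | succ t =>
    have h1 := Nat.choose_succ_succ m t
    have h2 := Nat.choose_succ_succ (m + 1) t
    have h3 := Nat.choose_le_choose t (Nat.le_succ m)
    simp only [Nat.succ_eq_add_one] at *
    rw [show m + 2 = m + 1 + 1 from rfl]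
    omega

/-- With `f m = m choose t` and `n = a + i + 4 + b`, the first two terms have second differences `i
Δ²f(a) + 2 Δf(a+1)` and `b Δ²f(a+b+1) + 4 Δf(a+b+2)`, both nonnegative; the third term is linear. -/
lemma two_mul_starSum_le {n t a i : ℕ} (h : a + i + 4 ≤ n) :
    2 * starSum n t (a + 1) (i + 1) ≤ starSum n t a i + starSum n t (a + 2) (i + 2) := by
  obtain ⟨b, rfl⟩ := Nat.exists_eq_add_of_le h
  have e1 : a + i + 4 + b - a - i = b + 4 := by omega
  have e2 : a + i + 4 + b - (a + 1) - (i + 1) = b + 2 := by omega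
  have e3 : a + i + 4 + b - (a + 2) - (i + 2) = b := by omega
  have e4 : a + i + 4 + b - 1 - i = a + b + 3 := by omega
  have e5 : a + i + 4 + b - 1 - (i + 1) = a + b + 2 := by omega
  have e6 : a + i + 4 + b - 1 - (i + 2) = a + b + 1 := by omega
  simp only [starSum, e1, e2, e3, e4, e5, e6]
  have c1 := two_mul_choose_succ_le a t
  have c2 := two_mul_choose_succ_le (a + b + 1) t
  have c3 := Nat.choose_le_choose t (Nat.le_succ (a + 1))
  have c4 := Nat.choose_le_choose t (Nat.le_succ (a + b + 2))
  simp only [Nat.succ_eq_add_one, add_assoc, Nat.reduceAdd] at c1 c2 c3 c4 ⊢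
  have d1 := Nat.mul_le_mul_left i c1
  have d2 := Nat.mul_le_mul_left b c2
  nlinarith

/-- A convex sequence attains its maximum at an end. -/
lemma le_max_of_convex {g : ℕ → ℕ} {N : ℕ} (h : ∀ j, j + 2 ≤ N → 2 * g (j + 1) ≤ g j + g (j + 1 + 1))
    {j : ℕ} (hj : j ≤ N) : g j ≤ max (g 0) (g N) := by
  -- By convexity, a strict descent at one step forces a strict descent at every earlier step.
  have hdec : ∀ j, j + 1 ≤ N → g (j + 1) < g j → g j ≤ g 0 := by
    intro j
    induction j with
    | zero => simp
    | succ j ih =>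
      intro hj hlt
      have := h j hj
      have := ih (by omega) (by omega)
      omega
  induction N with
  | zero => simp [Nat.le_zero.1 hj]
  | succ N ih =>
    rcases Nat.lt_or_ge N j with hj' | hj'
    · rw [show j = N + 1 by omega]
      exact le_max_right _ _
    · have h1 := ih (fun j hj => h j (by omega)) hj' (fun j hj => hdec j (by omega))
      rcases Nat.lt_or_ge (g (N + 1)) (g N) with h2 | h2
      · have := hdec N le_rfl h2
        omega
      · omega

lemma starSum_le_max {n t a i N j : ℕ} (hN : a + i + 2 * N ≤ n) (hj : j ≤ N) :
    starSum n t (a + j) (i + j) ≤ max (starSum n t a i) (starSum n t (a + N) (i + N)) :=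
  le_max_of_convex (g := fun j => starSum n t (a + j) (i + j))
    (fun j hj => two_mul_starSum_le (a := a + j) (i := i + j) (by omega)) hj

/-! ### Counting stars -/

/-- A copy amounts to its image `S` with an isomorphism from `H` onto `S`, and there are as many of
these as automorphisms of `H`. -/
lemma card_copy_eq {V W : Type*} [Fintype V] [Finite W] (G : SimpleGraph V) (H : SimpleGraph W) :
    Nat.card (Copy H G) = G.copyCount H * Nat.card (H ≃g H) := by
  classical
  cases nonempty_fintype W
  let f : (Σ S : {S : G.Subgraph // Nonempty (H ≃g S.coe)}, H ≃g S.1.coe) → Copy H G :=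
    fun x => ⟨x.1.1.hom.comp x.2.toHom, Subgraph.hom_injective.comp x.2.injective⟩
  have hf : Function.Bijective f := by
    constructor
    · rintro ⟨⟨S, hS⟩, e⟩ ⟨⟨S', hS'⟩, e'⟩ h
      have hval : ∀ x, (e x : V) = e' x := fun x => congrArg (fun c : Copy H G => c x) h
      have : S = S' := by
        have key : ∀ (S : G.Subgraph) (e : H ≃g S.coe), (f ⟨⟨S, ⟨e⟩⟩, e⟩).toSubgraph = S := by
          intro S e
          simp [f, Copy.toSubgraph, Subgraph.map_comp]
        rw [← key S e, ← key S' e']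
        exact congrArg Copy.toSubgraph h
      subst this
      have : e = e' := by
        ext x
        exact hval x
      rw [this]
    · intro c
      exact ⟨⟨⟨c.toSubgraph, ⟨c.isoToSubgraph⟩⟩, c.isoToSubgraph⟩, by ext x; rfl⟩
  have hcard : ∀ S : {S : G.Subgraph // Nonempty (H ≃g S.coe)},
      Nat.card (H ≃g S.1.coe) = Nat.card (H ≃g H) := by
    rintro ⟨S, ⟨e⟩⟩
    exact Nat.card_congr
      { toFun := fun x => x.trans e.symm
        invFun := fun x => x.trans e
        left_inv := fun x => by ext y; simp
        right_inv := fun x => by ext y; simp }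
  have : ∀ S : {S : G.Subgraph // Nonempty (H ≃g S.coe)}, Finite (H ≃g S.1.coe) := fun S =>
    Finite.of_injective (fun e => (e : W → S.1.verts)) DFunLike.coe_injective
  rw [← Nat.card_eq_of_bijective f hf, Nat.card_sigma, Finset.sum_congr rfl fun S _ => hcard S,
    Finset.sum_const, smul_eq_mul, Finset.card_univ, Fintype.card_subtype]
  simp only [copyCount]

/-- A labelled star is a centre together with an injection of the `t` leaves into its neighbourhood.
-/
lemma card_copy_star {V : Type*} [Fintype V] (G : SimpleGraph V) [DecidableRel G.Adj] (t : ℕ) :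
    Nat.card (Copy (completeBipartiteGraph (Fin 1) (Fin t)) G) =
      t.factorial * ∑ v, (G.degree v).choose t := by
  classical
  let f : (Σ v : V, Fin t ↪ G.neighborSet v) →
      Copy (completeBipartiteGraph (Fin 1) (Fin t)) G := fun x =>
    ⟨⟨Sum.elim (fun _ => x.1) (fun j => (x.2 j : V)), by
      rintro (a | a) (b | b) h
      · simp at h
      · exact (x.2 b).2
      · exact (x.2 a).2.symm
      · simp at h⟩, by
      rintro (a | a) (b | b) h
      · exact congrArg _ (Subsingleton.elim a b)
      · exact absurd h (x.2 b).2.ne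
      · exact absurd h (x.2 a).2.ne'
      · exact congrArg _ (x.2.injective (Subtype.ext h))⟩
  have hf : Function.Bijective f := by
    constructor
    · rintro ⟨v, e⟩ ⟨w, e'⟩ h
      have h0 : v = w := congrArg (fun c : Copy _ G => c (Sum.inl 0)) h
      subst h0
      have : e = e' := by
        ext j
        exact congrArg (fun c : Copy _ G => c (Sum.inr j)) h
      rw [this]
    · intro c
      refine ⟨⟨c (Sum.inl 0), ⟨fun j => ⟨c (Sum.inr j), c.toHom.map_adj (by simp)⟩, ?_⟩⟩, ?_⟩
      · intro j j' h
        exact Sum.inr_injective (c.injective (congrArg Subtype.val h))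
      · ext (x | x)
        · rw [Subsingleton.elim x 0]; rfl
        · rfl
  rw [← Nat.card_eq_of_bijective f hf, Nat.card_sigma, Finset.mul_sum]
  refine Finset.sum_congr rfl fun v _ => ?_
  rw [Nat.card_eq_fintype_card, Fintype.card_embedding_eq, Fintype.card_fin,
    card_neighborSet_eq_degree, Nat.descFactorial_eq_factorial_mul_choose]

lemma starCount_mul {V : Type*} [Fintype V] (G : SimpleGraph V) [DecidableRel G.Adj] (t : ℕ) :
    starCount t G * Nat.card
      (completeBipartiteGraph (Fin 1) (Fin t) ≃g completeBipartiteGraph (Fin 1) (Fin t)) =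
      t.factorial * ∑ v, (G.degree v).choose t := by
  rw [← card_copy_star, card_copy_eq, starCount]

/-- The order of the automorphism group cancels without being computed, so `t = 1`, where either end
may be the centre, needs no separate treatment. -/
lemma starCount_le_of_sum_le {V W : Type*} [Fintype V] [Fintype W] {G : SimpleGraph V}
    [DecidableRel G.Adj] {H : SimpleGraph W} [DecidableRel H.Adj] {t : ℕ}
    (h : ∑ v, (G.degree v).choose t ≤ ∑ v, (H.degree v).choose t) :
    starCount t G ≤ starCount t H := by
  have : Finite
      (completeBipartiteGraph (Fin 1) (Fin t) ≃g completeBipartiteGraph (Fin 1) (Fin t)) :=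
    Finite.of_injective (fun e => (e : Fin 1 ⊕ Fin t → Fin 1 ⊕ Fin t)) DFunLike.coe_injective
  have : Nonempty
      (completeBipartiteGraph (Fin 1) (Fin t) ≃g completeBipartiteGraph (Fin 1) (Fin t)) :=
    ⟨Iso.refl⟩
  refine Nat.le_of_mul_le_mul_right ?_ (Nat.card_pos (α :=
    completeBipartiteGraph (Fin 1) (Fin t) ≃g completeBipartiteGraph (Fin 1) (Fin t)))
  rw [starCount_mul, starCount_mul]
  exact Nat.mul_le_mul_left _ h

/-! ### The extremal graphs -/

/-- The join of `K_a` with `I_i ∪ K_b`. -/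
abbrev joinGraph (a i b : ℕ) : SimpleGraph (Fin a ⊕ (Fin i ⊕ Fin b)) :=
  join (completeGraph (Fin a)) (emptyGraph (Fin i) ⊕g completeGraph (Fin b))

section joinGraph

variable {a i b : ℕ}

@[simp] lemma joinGraph_adj_inl {x : Fin a} {y : Fin a ⊕ (Fin i ⊕ Fin b)} :
    (joinGraph a i b).Adj (Sum.inl x) y ↔ y ≠ Sum.inl x := by
  rcases y with y | y | y <;> simp [joinGraph, join, eq_comm]

@[simp] lemma joinGraph_adj_inr_inl {x : Fin i} {y : Fin a ⊕ (Fin i ⊕ Fin b)} :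
    (joinGraph a i b).Adj (Sum.inr (Sum.inl x)) y ↔ ∃ z, y = Sum.inl z := by
  rcases y with y | y | y <;> simp [joinGraph, join]

@[simp] lemma joinGraph_adj_inr_inr {x : Fin b} {y : Fin a ⊕ (Fin i ⊕ Fin b)} :
    (joinGraph a i b).Adj (Sum.inr (Sum.inr x)) y ↔
      y ≠ Sum.inr (Sum.inr x) ∧ ∀ z, y ≠ Sum.inr (Sum.inl z) := by
  rcases y with y | y | y <;> simp [joinGraph, join, eq_comm]

variable [DecidableRel (joinGraph a i b).Adj]

lemma degree_joinGraph_inl (x : Fin a) :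
    (joinGraph a i b).degree (Sum.inl x) = a + i + b - 1 := by
  classical
  have : (joinGraph a i b).neighborFinset (Sum.inl x) = Finset.univ.erase (Sum.inl x) := by
    ext y
    simp
  rw [← card_neighborFinset_eq_degree, this, Finset.card_erase_of_mem (Finset.mem_univ _)]
  simp [add_assoc]

lemma degree_joinGraph_inr_inl (x : Fin i) :
    (joinGraph a i b).degree (Sum.inr (Sum.inl x)) = a := by
  classical
  have : (joinGraph a i b).neighborFinset (Sum.inr (Sum.inl x)) =
      Finset.univ.map .inl := by
    ext y
    simp [eq_comm]
  rw [← card_neighborFinset_eq_degree, this]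
  simp

lemma degree_joinGraph_inr_inr (x : Fin b) :
    (joinGraph a i b).degree (Sum.inr (Sum.inr x)) = a + b - 1 := by
  classical
  have : (joinGraph a i b).neighborFinset (Sum.inr (Sum.inr x)) =
      (Finset.univ.disjSum ((∅ : Finset (Fin i)).disjSum Finset.univ)).erase
        (Sum.inr (Sum.inr x)) := by
    ext y
    rcases y with y | y | y <;> simp
  rw [← card_neighborFinset_eq_degree, this, Finset.card_erase_of_mem (by simp)]
  simp

lemma sum_choose_degree_joinGraph (t : ℕ) :
    ∑ v, ((joinGraph a i b).degree v).choose t = starSum (a + i + b) t a i := by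
  rw [Fintype.sum_sum_type, Fintype.sum_sum_type]
  simp only [degree_joinGraph_inl, degree_joinGraph_inr_inl, degree_joinGraph_inr_inr,
    Finset.sum_const, Finset.card_univ, Fintype.card_fin, smul_eq_mul, starSum]
  rw [show a + i + b - a - i = b by omega, show a + i + b - 1 - i = a + b - 1 by omega]
  omega

end joinGraph

lemma isBarrier_joinGraph {a i b : ℕ} {ℓ : ℤ} (hi : 1 ≤ i) (hb : 1 ≤ b) (ha : (a : ℤ) = i + ℓ) :
    IsBarrier (joinGraph a i b) ℓ (Finset.univ.map .inl)
      (Finset.univ.map (Function.Embedding.inl.trans .inr)) where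
  disjoint := by simp [Finset.disjoint_left]
  nonempty := ⟨Sum.inr (Sum.inl ⟨0, hi⟩), by simp⟩
  card_eq := by simpa using ha
  exists_notMem := ⟨Sum.inr (Sum.inr ⟨0, hb⟩), by simp⟩
  mem_of_adj x hx y hxy := by
    obtain ⟨x, -, rfl⟩ := Finset.mem_map.1 hx
    simpa [eq_comm] using joinGraph_adj_inr_inl.1 hxy
  adj x hx y hy hxy := by
    obtain ⟨x, -, rfl⟩ := Finset.mem_map.1 hx
    exact joinGraph_adj_inl.2 hxy.symm

lemma IsBarrier.comap {V W : Type*} {H : SimpleGraph W} {ℓ : ℤ} {A I : Finset W}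
    (h : IsBarrier H ℓ A I) (e : V ≃ W) :
    IsBarrier (H.comap e) ℓ (A.map e.symm.toEmbedding) (I.map e.symm.toEmbedding) where
  disjoint := (Finset.disjoint_map _).2 h.disjoint
  nonempty := h.nonempty.map
  card_eq := by simpa using h.card_eq
  exists_notMem := by
    obtain ⟨w, hw, hw'⟩ := h.exists_notMem
    exact ⟨e.symm w, by simpa using hw, by simpa using hw'⟩
  mem_of_adj x hx y hxy := by
    rw [Finset.mem_map_equiv, Equiv.symm_symm] at hx ⊢
    exact h.mem_of_adj _ hx _ hxy
  adj x hx y hy hxy := by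
    rw [Finset.mem_map_equiv, Equiv.symm_symm] at hx hy
    exact h.adj _ hx _ hy fun h' => hxy (e.injective h')

/-- The extremal graphs, on a given set of vertices. -/
lemma IsHamiltonLike.exists_extremal {V : Type*} [Fintype V] [DecidableEq V]
    {P : SimpleGraph V → Prop} {ℓ : ℤ} (hP : IsHamiltonLike P ℓ) {a i b : ℕ} (hi : 1 ≤ i)
    (hb : 1 ≤ b) (ha : (a : ℤ) = i + ℓ) (hV : Fintype.card V = a + i + b) (t : ℕ) :
    ∃ (H : SimpleGraph V) (_ : DecidableRel H.Adj), a ≤ H.minDegree ∧ ¬ P H ∧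
      starCount t H = starCount t (joinGraph a i b) := by
  classical
  have e : V ≃ Fin a ⊕ (Fin i ⊕ Fin b) := Fintype.equivOfCardEq (by simp [hV, add_assoc])
  have hdeg : ∀ v, ((joinGraph a i b).comap e).degree v = (joinGraph a i b).degree (e v) :=
    fun v => ((Iso.comap e (joinGraph a i b)).degree_eq v).symm
  refine ⟨(joinGraph a i b).comap e, inferInstance, ?_,
    hP.not_of_isBarrier _ _ _ ((isBarrier_joinGraph hi hb ha).comap e), ?_⟩
  · have : Nonempty V := Fintype.card_pos_iff.1 (by omega)
    refine le_minDegree_of_forall_le_degree _ _ fun v => ?_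
    rw [hdeg]
    rcases e v with x | x | x
    · rw [degree_joinGraph_inl]; omega
    · rw [degree_joinGraph_inr_inl]
    · rw [degree_joinGraph_inr_inr]; omega
  · have : ∑ v, (((joinGraph a i b).comap e).degree v).choose t =
        ∑ v, ((joinGraph a i b).degree v).choose t := by
      simp only [hdeg]
      exact Equiv.sum_comp e fun v => ((joinGraph a i b).degree v).choose t
    exact le_antisymm (starCount_le_of_sum_le this.le) (starCount_le_of_sum_le this.ge)

/-- The bound on the number of stars, for any Hamilton-type property. -/
lemma IsHamiltonLike.starCount_bound {V : Type*} [Fintype V] [DecidableEq V]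
    {P : SimpleGraph V → Prop} {ℓ : ℤ} (hP : IsHamiltonLike P ℓ) (hℓ : -1 ≤ ℓ) {n d : ℕ} (t : ℕ)
    (hV : Fintype.card V = n) (hn : ℓ ≤ (n : ℤ) - 3) (hd : (d : ℤ) ≤ ((n : ℤ) + ℓ - 1) / 2) :
    (∀ (G : SimpleGraph V) [DecidableRel G.Adj], d ≤ G.minDegree → ¬ P G →
      starCount t G ≤ max (starCount t (extremalGraph n ℓ (iMin d ℓ)))
        (starCount t (extremalGraph n ℓ (iTop n ℓ)))) ∧
    ∃ (H : SimpleGraph V) (_ : DecidableRel H.Adj), d ≤ H.minDegree ∧ ¬ P H ∧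
      starCount t H = max (starCount t (extremalGraph n ℓ (iMin d ℓ)))
        (starCount t (extremalGraph n ℓ (iTop n ℓ))) := by
  classical
  subst hV
  set n := Fintype.card V
  have h1 : (1 : ℤ) ≤ iMin d ℓ := le_max_left _ _
  have h2 : (d : ℤ) - ℓ ≤ iMin d ℓ := le_max_right _ _
  -- The bounds on `ℓ` and `d` give `1 ≤ i₀` and `d - ℓ ≤ i₀` respectively.
  have h3 : iMin d ℓ ≤ iTop n ℓ := by unfold iMin iTop; omega
  have h4 : 2 * iTop n ℓ + ℓ + 1 ≤ n := by unfold iTop; omega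
  have hmin : ∀ j, 1 ≤ j → (d : ℤ) - ℓ ≤ j → iMin d ℓ ≤ j := fun j hj hj' => max_le hj hj'
  have htop : ∀ j, 2 * j + ℓ + 1 ≤ n → j ≤ iTop n ℓ := by unfold iTop; omega
  have hsum : ∀ j : ℤ, 1 ≤ j → 2 * j + ℓ + 1 ≤ n →
      ∑ v, ((extremalGraph n ℓ j).degree v).choose t = starSum n t (j + ℓ).toNat j.toNat := by
    intro j hj hj'
    have := sum_choose_degree_joinGraph (a := (j + ℓ).toNat) (i := j.toNat)
      (b := (n - 2 * j - ℓ).toNat) t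
    rw [show (j + ℓ).toNat + j.toNat + (n - 2 * j - ℓ).toNat = n by omega] at this
    exact this
  have hext : ∀ j : ℤ, 1 ≤ j → (d : ℤ) - ℓ ≤ j → 2 * j + ℓ + 1 ≤ n →
      ∃ (H : SimpleGraph V) (_ : DecidableRel H.Adj), d ≤ H.minDegree ∧ ¬ P H ∧
        starCount t H = starCount t (extremalGraph n ℓ j) := by
    intro j hj hj' hj''
    obtain ⟨H, hH, hdeg, hPH, hst⟩ := hP.exists_extremal (a := (j + ℓ).toNat) (i := j.toNat)
      (b := (n - 2 * j - ℓ).toNat) (by omega) (by omega) (by omega) (by omega) t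
    exact ⟨H, hH, by omega, hPH, hst⟩
  constructor
  · intro G _ hdG hG
    obtain ⟨G', _, a, i, hGG', hi, ha, hai, hc1, hc2⟩ :=
      hP.exists_degree_bounds hℓ (by omega) hG
    -- Since `i ≥ 1`, some vertex has degree at most `a` in `G'`, hence also in `G`. This places `i
    -- = a - ℓ` at or above `i_d`.
    have hda : d ≤ a := by
      obtain ⟨v, hv⟩ := Finset.card_pos.1 (hi.trans hc1)
      exact hdG.trans ((G.minDegree_le_degree v).trans
        ((degree_le_of_le hGG').trans (Finset.mem_filter.1 hv).2))
    have hle : ∑ v, (G.degree v).choose t ≤ starSum n t a i :=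
      (Finset.sum_le_sum fun v _ => Nat.choose_le_choose t (degree_le_of_le hGG')).trans
        (sum_choose_degree_le t hai hc1 hc2)
    have hlo := hmin i (by omega) (by omega)
    have hhi := htop i (by omega)
    obtain ⟨N, hN⟩ := Int.le.dest h3
    obtain ⟨j, hj⟩ := Int.le.dest hlo
    have hmax := starSum_le_max (n := n) (t := t) (a := (iMin d ℓ + ℓ).toNat)
      (i := (iMin d ℓ).toNat) (N := N) (j := j) (by omega) (by omega)
    rw [show (iMin d ℓ + ℓ).toNat + j = a by omega, show (iMin d ℓ).toNat + j = i by omega,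
      show (iMin d ℓ + ℓ).toNat + N = (iTop n ℓ + ℓ).toNat by omega,
      show (iMin d ℓ).toNat + N = (iTop n ℓ).toNat by omega,
      ← hsum _ h1 (by omega), ← hsum _ (by omega) h4] at hmax
    rcases le_max_iff.1 (hle.trans hmax) with h | h
    · exact (starCount_le_of_sum_le h).trans (le_max_left _ _)
    · exact (starCount_le_of_sum_le h).trans (le_max_right _ _)
  · rcases max_choice (starCount t (extremalGraph n ℓ (iMin d ℓ)))
      (starCount t (extremalGraph n ℓ (iTop n ℓ))) with h | h <;> rw [h]
    · exact hext _ h1 h2 (by omega)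
    · exact hext _ (by omega) (by omega) h4

end StarsForbidden

theorem theorem1p5 {V : Type*} [Fintype V] [DecidableEq V] (n d t : ℕ) (ℓ : ℤ)
    (P : SimpleGraph V → Prop)
    (hV : Fintype.card V = n) (ht₁ : 1 ≤ t) (ht₂ : t ≤ n - 1)
    (hP : (P = SimpleGraph.IsHamiltonian ∧ ℓ = 0) ∨
      (P = StarsForbidden.IsTraceable ∧ ℓ = -1) ∨
      (P = StarsForbidden.IsHamiltonianConnected ∧ ℓ = 1) ∨
      (∃ k : ℕ, 1 ≤ k ∧ k + 3 ≤ n ∧ P = StarsForbidden.IsEdgeHamiltonian k ∧ ℓ = k) ∨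
      (∃ k : ℕ, 1 ≤ k ∧ k + 3 ≤ n ∧ P = StarsForbidden.IsKHamiltonian k ∧ ℓ = k))
    (hn : ℓ ≤ (n : ℤ) - 3) (hd : (d : ℤ) ≤ ((n : ℤ) + ℓ - 1) / 2) :
    (∀ (G : SimpleGraph V) [DecidableRel G.Adj], d ≤ G.minDegree → ¬ P G →
      StarsForbidden.starCount t G ≤
        max (StarsForbidden.starCount t
              (StarsForbidden.extremalGraph n ℓ (StarsForbidden.iMin d ℓ)))
            (StarsForbidden.starCount t
              (StarsForbidden.extremalGraph n ℓ (StarsForbidden.iTop n ℓ)))) ∧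
    (∃ (H : SimpleGraph V) (_ : DecidableRel H.Adj), d ≤ H.minDegree ∧ ¬ P H ∧
      StarsForbidden.starCount t H =
        max (StarsForbidden.starCount t
              (StarsForbidden.extremalGraph n ℓ (StarsForbidden.iMin d ℓ)))
            (StarsForbidden.starCount t
              (StarsForbidden.extremalGraph n ℓ (StarsForbidden.iTop n ℓ)))) := by
  have h : StarsForbidden.IsHamiltonLike P ℓ ∧ -1 ≤ ℓ := by
    rcases hP with ⟨rfl, rfl⟩ | ⟨rfl, rfl⟩ | ⟨rfl, rfl⟩ | ⟨k, _, _, rfl, rfl⟩ | ⟨k, _, _, rfl, rfl⟩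
    · exact ⟨StarsForbidden.isHamiltonLike_isHamiltonian (by omega), by omega⟩
    · exact ⟨StarsForbidden.isHamiltonLike_isTraceable (by omega), by omega⟩
    · exact ⟨StarsForbidden.isHamiltonLike_isHamiltonianConnected (by omega), by omega⟩
    · exact ⟨StarsForbidden.isHamiltonLike_isEdgeHamiltonian (by omega), by omega⟩
    · exact ⟨StarsForbidden.isHamiltonLike_isKHamiltonian (by omega), by omega⟩
  exact h.1.starCount_bound h.2 t hV hn hd
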